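/- Let $\mathcal A$ be a finite set, let $t=(t_\alpha)_{\alpha\in\mathcal A}$ be variables, and let $Q=(Q_{\alpha\beta})$ be a symmetric matrix with integer entries indexed by $\mathcal A$. Put $$f_{\mathcal A,Q}(t)=\frac{1}{1-\sum_{\alpha\in\mathcal A}(-1)^{Q_{\alpha\alpha}}t_\alpha},\qquad R=\mathbb Z[t][f_{\mathcal A,Q}(t)],$$ $$f_{\mathcal A,Q}(t,q)=\sum_{k\in\mathbb Z_{\ge0}^{\mathcal A}}(-1)^{\mathrm{diag}(Q)k}\,q^{\frac12k^tQk+\frac12\mathrm{diag}(Q)k}\,\frac{(q;q)_{\sum_\alpha k_\alpha}}{\prod_\alpha(q;q)_{k_\alpha}}\prod_\alpha t_\alpha^{k_\alpha}\in\mathbb Z[q^{\pm1}][\![t]\!],$$ where $\mathrm{diag}(Q)k=\sum_\alpha Q_{\alpha\alpha}k_\alpha$ and $(q;q)_n=\prod_{i=1}^n(1-q^i)$. Fix complex roots of unity $\zeta_m$ of exact order $m$ ($m\ge1$) such that $\zeta_{mm'}=\zeta_m\zeta_{m'}$ for coprime $m,m'$ and $(\zeta_{p^r})^p=\zeta_{p^{r-1}}$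 for primes $p$ and $r\ge1$. For an étale $\mathbb Z[t]$-algebra $R$ let $R_m=R[t^{1/m},\zeta_m]$ be the base change of $R$ along $\mathbb Z[t]\to\mathbb Z[\zeta_m][t^{1/m}]$. For a prime $p$ let $\varphi_p:R_m\to(R_m)^\wedge_p$ be the unique ring homomorphism to the $p$-adic completion with $\varphi_p(\zeta_m)=\zeta_m$, $\varphi_p(t_\alpha^{1/m})=t_\alpha^{p/m}$, and $\varphi_p(x)\equiv x^p \pmod p$ for $x\in R$. The Habiro ring $\mathcal H_{R/\mathbb Z[t]}$ consists of the collections $(f_m(q-\zeta_m))_{m\ge1}\in\prod_{m\ge1}R_m[\![q-\zeta_m]\!]$ such that, for all $m\ge1$ and all primes $p$, $$f_m\big(q-\zeta_{pm}+(\zeta_{pm}-\zeta_m)\big)=\varphi_p f_{pm}(q-\zeta_{pm})\quad\text{in }(R_{pm})^\wedge_p[\![q-\zeta_{pm}]\!],$$ where $\varphi_p$ acts on the coefficients. **Theorem.** One has $f_{\mathcal A,Q}(t,q)\in\mathcal H_{R/\mathbb Z[t]}$ for $R=\mathbb Z[t][f_{\mathcal A,Q}(t)]$. That is, there is a unique element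 $(f_m)_{m\ge1}$ of $\mathcal H_{R/\mathbb Z[t]}$ such that, for every $m\ge1$, the image of $f_m$ in $\mathbb Z[\zeta_m][\![t^{1/m}]\!][\![q-\zeta_m]\!]$, obtained by expanding the coefficients at $t=0$, is the expansion of $f_{\mathcal A,Q}(t^{1/m},q)$ at $q=\zeta_m$. -/

import Mathlib

open scoped BigOperators TensorProduct LaurentPolynomial Polynomial

noncomputable section

namespace Habiro

/-! ## Compatible roots of unity and the rings `R_m = R[t^{1/m}, ζ_m]` -/

/-- A compatible collection of complex roots of unity: `ζ_m` is a primitive `m`-th root of unity,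
`ζ_{m m'} = ζ_m ζ_{m'}` for coprime `m, m'`, and `(ζ_{p^{r+1}})^p = ζ_{p^r}` for primes `p`. -/
structure RootSystem where
  /-- the root of unity of order `m` -/
  root : ℕ+ → ℂ
  primitive : ∀ m : ℕ+, IsPrimitiveRoot (root m) (m : ℕ)
  mul_of_coprime : ∀ m m' : ℕ+, Nat.Coprime m m' → root (m * m') = root m * root m'
  pow_prime : ∀ p : ℕ+, Nat.Prime p → ∀ r : ℕ, root (p ^ (r + 1)) ^ (p : ℕ) = root (p ^ r)

/-- The ring `ℤ[ζ_m]`, as a subring of `ℂ`. -/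
abbrev Cyc (Z : RootSystem) (m : ℕ+) : Subalgebra ℤ ℂ := Algebra.adjoin ℤ {Z.root m}

/-- `ζ_m` as an element of `ℤ[ζ_m]`. -/
def zeta (Z : RootSystem) (m : ℕ+) : Cyc Z m :=
  ⟨Z.root m, Algebra.subset_adjoin (Set.mem_singleton _)⟩

theorem root_mem (Z : RootSystem) (p m : ℕ+) : Z.root m ∈ Cyc Z (p * m) := by
  have h : Z.root m ^ ((p * m : ℕ+) : ℕ) = 1 := by
    rw [PNat.mul_coe, mul_comm, pow_mul, (Z.primitive m).pow_eq_one, one_pow]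
  have : NeZero ((p * m : ℕ+) : ℕ) := ⟨(p * m).ne_zero⟩
  obtain ⟨i, -, hi⟩ := (Z.primitive (p * m)).eq_pow_of_pow_eq_one h
  rw [← hi]
  exact pow_mem (Algebra.subset_adjoin (Set.mem_singleton _)) i

/-- `ζ_m` as an element of `ℤ[ζ_{pm}]`. -/
def zetaIn (Z : RootSystem) (p m : ℕ+) : Cyc Z (p * m) := ⟨Z.root m, root_mem Z p m⟩

/-- The inclusion `ℤ[ζ_m] ⊆ ℤ[ζ_{pm}]`. -/
def cycIncl (Z : RootSystem) (p m : ℕ+) : Cyc Z m →ₐ[ℤ] Cyc Z (p * m) :=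
  Subalgebra.inclusion (Algebra.adjoin_le (Set.singleton_subset_iff.2 (root_mem Z p m)))

variable {σ : Type*}

/-- The ring `ℤ[ζ_m][t^{1/m}]`. It is the polynomial ring over `ℤ[ζ_m]` in variables
`s_α = t_α^{1/m}`; it is a type synonym because it is regarded as a `ℤ[t]`-algebra
through `t_α ↦ s_α ^ m`. -/
def RootPoly (σ : Type*) (Z : RootSystem) (m : ℕ+) : Type _ := MvPolynomial σ (Cyc Z m)

instance (Z : RootSystem) (m : ℕ+) : CommRing (RootPoly σ Z m) :=
  inferInstanceAs (CommRing (MvPolynomial σ (Cyc Z m)))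

/-- The constants `ℤ[ζ_m] → ℤ[ζ_m][t^{1/m}]`. -/
def RootPoly.const (Z : RootSystem) (m : ℕ+) : Cyc Z m →+* RootPoly σ Z m :=
  (MvPolynomial.C : Cyc Z m →+* MvPolynomial σ (Cyc Z m))

/-- The variable `t_α^{1/m}`. -/
def RootPoly.var (Z : RootSystem) (m : ℕ+) (α : σ) : RootPoly σ Z m :=
  (MvPolynomial.X α : MvPolynomial σ (Cyc Z m))

/-- The ring homomorphism out of `ℤ[ζ_m][t^{1/m}]` with given values on constants and variables. -/
def RootPoly.lift {Z : RootSystem} {m : ℕ+} {S : Type*} [CommRing S]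
    (c : Cyc Z m →+* S) (v : σ → S) : RootPoly σ Z m →+* S :=
  (MvPolynomial.eval₂Hom c v : MvPolynomial σ (Cyc Z m) →+* S)

@[simp] theorem RootPoly.lift_const {Z : RootSystem} {m : ℕ+} {S : Type*} [CommRing S]
    (c : Cyc Z m →+* S) (v : σ → S) (z : Cyc Z m) :
    RootPoly.lift c v (RootPoly.const Z m z) = c z :=
  MvPolynomial.eval₂Hom_C c v z

@[simp] theorem RootPoly.lift_var {Z : RootSystem} {m : ℕ+} {S : Type*} [CommRing S]
    (c : Cyc Z m →+* S) (v : σ → S) (α : σ) :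
    RootPoly.lift c v (RootPoly.var Z m α) = v α :=
  MvPolynomial.eval₂Hom_X' c v α

theorem RootPoly.hom_ext {Z : RootSystem} {m : ℕ+} {S : Type*} [CommRing S]
    {f g : RootPoly σ Z m →+* S}
    (hc : ∀ z, f (RootPoly.const Z m z) = g (RootPoly.const Z m z))
    (hv : ∀ α, f (RootPoly.var Z m α) = g (RootPoly.var Z m α)) : f = g :=
  MvPolynomial.ringHom_ext (R := Cyc Z m) hc hv

/-- `ℤ[t] → ℤ[ζ_m][t^{1/m}]`, `t_α ↦ (t_α^{1/m})^m`. -/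
instance (Z : RootSystem) (m : ℕ+) : Algebra (MvPolynomial σ ℤ) (RootPoly σ Z m) :=
  (MvPolynomial.eval₂Hom (Int.castRingHom (RootPoly σ Z m))
    (fun α => RootPoly.var Z m α ^ (m : ℕ))).toAlgebra

theorem RootPoly.algebraMap_X (Z : RootSystem) (m : ℕ+) (α : σ) :
    algebraMap (MvPolynomial σ ℤ) (RootPoly σ Z m) (MvPolynomial.X α) =
      RootPoly.var Z m α ^ (m : ℕ) :=
  MvPolynomial.eval₂Hom_X' _ _ α

variable (R : Type*) [CommRing R] [Algebra (MvPolynomial σ ℤ) R]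

/-- `R_m = R[t^{1/m}, ζ_m]`, the base change of the `ℤ[t]`-algebra `R` to `ℤ[ζ_m][t^{1/m}]`. -/
abbrev Ext (Z : RootSystem) (m : ℕ+) : Type _ := R ⊗[MvPolynomial σ ℤ] RootPoly σ Z m

section Tensor

variable {A : Type*} [CommRing A] {B C S : Type*} [CommRing B] [CommRing C] [CommRing S]
  [Algebra A B] [Algebra A C]

/-- Two ring homomorphisms that agree on `A` define one on `B ⊗[A] C`. -/
def tensorLift (f : B →+* S) (g : C →+* S)
    (h : f.comp (algebraMap A B) = g.comp (algebraMap A C)) : B ⊗[A] C →+* S :=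
  letI : Algebra A S := (f.comp (algebraMap A B)).toAlgebra
  (Algebra.TensorProduct.productMap (R := A) (A := B) (B := C) (S := S)
    { f with commutes' := fun _ => rfl }
    { g with commutes' := fun a => (RingHom.congr_fun h a).symm }).toRingHom

@[simp] theorem tensorLift_tmul (f : B →+* S) (g : C →+* S)
    (h : f.comp (algebraMap A B) = g.comp (algebraMap A C)) (b : B) (c : C) :
    tensorLift f g h (b ⊗ₜ[A] c) = f b * g c := rfl

theorem tensor_hom_ext {F G : B ⊗[A] C →+* S} (hB : ∀ b, F (b ⊗ₜ 1) = G (b ⊗ₜ 1))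
    (hC : ∀ c, F (1 ⊗ₜ c) = G (1 ⊗ₜ c)) : F = G := by
  refine RingHom.ext fun x => ?_
  induction x using TensorProduct.induction_on with
  | zero => simp
  | add x y hx hy => simp [hx, hy]
  | tmul b c =>
    have : b ⊗ₜ[A] c = (b ⊗ₜ[A] (1 : C)) * ((1 : B) ⊗ₜ[A] c) := by simp
    rw [this, map_mul, map_mul, hB, hC]

end Tensor

/-- The map `ℤ[ζ_m][t^{1/m}] → ℤ[ζ_{pm}][t^{1/pm}]`, `t_α^{1/m} ↦ (t_α^{1/pm})^p`. -/
def RootPoly.incl (Z : RootSystem) (p m : ℕ+) : RootPoly σ Z m →+* RootPoly σ Z (p * m) :=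
  RootPoly.lift ((RootPoly.const Z (p * m)).comp (cycIncl Z p m).toRingHom)
    (fun α => RootPoly.var Z (p * m) α ^ (p : ℕ))

theorem RootPoly.incl_algebraMap (Z : RootSystem) (p m : ℕ+) (a : MvPolynomial σ ℤ) :
    RootPoly.incl Z p m (algebraMap _ _ a) = algebraMap _ (RootPoly σ Z (p * m)) a := by
  suffices h : (RootPoly.incl Z p m).comp (algebraMap (MvPolynomial σ ℤ) (RootPoly σ Z m)) =
      algebraMap _ (RootPoly σ Z (p * m)) from RingHom.congr_fun h a
  refine MvPolynomial.ringHom_ext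
    (fun z => RingHom.congr_fun (RingHom.ext_int
      (((RootPoly.incl Z p m).comp (algebraMap (MvPolynomial σ ℤ) (RootPoly σ Z m))).comp
        MvPolynomial.C)
      ((algebraMap (MvPolynomial σ ℤ) (RootPoly σ Z (p * m))).comp MvPolynomial.C)) z)
    (fun α => ?_)
  rw [RingHom.comp_apply, RootPoly.algebraMap_X, RootPoly.algebraMap_X, map_pow, RootPoly.incl,
    RootPoly.lift_var, ← pow_mul, PNat.mul_coe]

/-- The natural map `R_m → R_{pm}`. -/
def Ext.incl (Z : RootSystem) (p m : ℕ+) : Ext (σ := σ) R Z m →+* Ext (σ := σ) R Z (p * m) :=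
  (Algebra.TensorProduct.map (AlgHom.id (MvPolynomial σ ℤ) R)
    { RootPoly.incl Z p m with
      commutes' := RootPoly.incl_algebraMap Z p m }).toRingHom

/-! ## The Frobenius lift on the `p`-adic completion -/

/-- The ideal `(p)` of `R_m`. -/
abbrev pIdeal (Z : RootSystem) (p m : ℕ+) : Ideal (Ext (σ := σ) R Z m) :=
  Ideal.span {((p : ℕ) : Ext (σ := σ) R Z m)}

/-- The `p`-adic completion of `R_m`. -/
abbrev ExtHat (Z : RootSystem) (p m : ℕ+) : Type _ :=
  AdicCompletion (pIdeal (σ := σ) R Z p m) (Ext (σ := σ) R Z m)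

/-- `φ : R_m → (R_m)^∧_p` is the `p`-Frobenius: it fixes `ζ_m`, it sends
`t_α^{1/m}` to `(t_α^{1/m})^p`, and on `R` it reduces to `x ↦ x^p` modulo `p`. -/
structure IsFrobenius (Z : RootSystem) (p m : ℕ+)
    (φ : Ext (σ := σ) R Z m →+* ExtHat (σ := σ) R Z p m) : Prop where
  map_const : ∀ z : Cyc Z m, φ (1 ⊗ₜ RootPoly.const Z m z) =
    algebraMap _ _ ((1 : R) ⊗ₜ[MvPolynomial σ ℤ] (RootPoly.const Z m z : RootPoly σ Z m))
  map_var : ∀ α : σ, φ (1 ⊗ₜ RootPoly.var Z m α) =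
    algebraMap _ _ ((1 : R) ⊗ₜ[MvPolynomial σ ℤ] RootPoly.var Z m α) ^ (p : ℕ)
  map_mod_p : ∀ r : R, AdicCompletion.evalOneₐ _ (φ (r ⊗ₜ 1)) =
    Ideal.Quotient.mk (pIdeal (σ := σ) R Z p m) (r ⊗ₜ 1) ^ (p : ℕ)

/-- In a ring with `p = 0`, the map `x ↦ x^p` is a ring homomorphism. -/
def powHom {C : Type*} [CommRing C] {p : ℕ} (hp : p.Prime) (h : (p : C) = 0) : C →+* C where
  toFun x := x ^ p
  map_one' := one_pow _
  map_mul' x y := mul_pow x y p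
  map_zero' := zero_pow hp.ne_zero
  map_add' x y := by
    obtain ⟨r, hr⟩ := exists_add_pow_prime_eq hp x y
    rw [hr, h]; simp

theorem sub_pow_pow {C : Type*} [CommRing C] {p : ℕ} (hp : p.Prime) (h : (p : C) = 0) (x y : C)
    (n : ℕ) : (x - y) ^ p ^ n = x ^ p ^ n - y ^ p ^ n := by
  induction n with
  | zero => simp
  | succ n ih =>
    rw [pow_succ, pow_mul, pow_mul, pow_mul, ih]
    exact map_sub (powHom hp h) _ _

section Lifting

variable {A : Type*} [CommRing A] {B S : Type*} [CommRing B] [CommRing S] [Algebra A B]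

theorem exists_lift_completion [Algebra.FormallySmooth A B] (I : Ideal S) (ψ : A →+* S)
    (f : B →+* S ⧸ I) (h : f.comp (algebraMap A B) = (Ideal.Quotient.mk I).comp ψ) :
    ∃ g : B →+* AdicCompletion I S, (∀ b, AdicCompletion.evalOneₐ I (g b) = f b) ∧
      g.comp (algebraMap A B) = (algebraMap S (AdicCompletion I S)).comp ψ := by
  let _ : Algebra A S := ψ.toAlgebra
  obtain ⟨g, hg⟩ := Algebra.FormallySmooth.exists_adicCompletionEvalOneₐ_comp_eq (R := A) (A := B)
    (I := I) { f with commutes' := fun a => RingHom.congr_fun h a }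
  refine ⟨g.toRingHom, fun b => DFunLike.congr_fun hg b, ?_⟩
  ext a : 1
  exact g.commutes a

theorem lift_completion_unique [Algebra.FormallyUnramified A B] (I : Ideal S)
    (g₁ g₂ : B →+* AdicCompletion I S)
    (hA : g₁.comp (algebraMap A B) = g₂.comp (algebraMap A B))
    (hI : ∀ b, AdicCompletion.evalOneₐ I (g₁ b) = AdicCompletion.evalOneₐ I (g₂ b)) :
    g₁ = g₂ := by
  ext b : 1
  refine AdicCompletion.ext_evalₐ fun n => ?_
  rcases Nat.eq_zero_or_pos n with rfl | hn
  · have : Subsingleton (S ⧸ I ^ 0) := by simp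
    exact Subsingleton.elim _ _
  let _ : Algebra A (S ⧸ I ^ n) :=
    (((AdicCompletion.evalₐ I n : _ →+* S ⧸ I ^ n).comp g₁).comp (algebraMap A B)).toAlgebra
  let G₁ : B →ₐ[A] S ⧸ I ^ n :=
    { (AdicCompletion.evalₐ I n : _ →+* S ⧸ I ^ n).comp g₁ with commutes' := fun a => rfl }
  let G₂ : B →ₐ[A] S ⧸ I ^ n :=
    { (AdicCompletion.evalₐ I n : _ →+* S ⧸ I ^ n).comp g₂ with
      commutes' := fun a =>
        (congrArg (AdicCompletion.evalₐ I n) (RingHom.congr_fun hA a)).symm }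
  have hle : I ^ n ≤ I := Ideal.pow_le_self hn.ne'
  have key : ∀ x : AdicCompletion I S, Ideal.Quotient.factor hle (AdicCompletion.evalₐ I n x) =
      AdicCompletion.evalOneₐ I x := by
    intro x
    induction x using AdicCompletion.induction_on with
    | _ x =>
      rw [← AdicCompletion.factorₐ_evalₐ_one, AdicCompletion.evalₐ_mk, AdicCompletion.evalₐ_mk,
        Ideal.Quotient.factor_mk, Ideal.Quotient.factor_mk]
      have h := congrArg (Ideal.Quotient.factor (show I ^ 1 ≤ I by simp))
        (AdicCompletion.Ideal.mk_eq_mk (I := I) (show 1 ≤ n from hn) x)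
      rwa [Ideal.Quotient.factor_mk, Ideal.Quotient.factor_mk] at h
  have : G₁ = G₂ := by
    refine Algebra.FormallyUnramified.ext' (Ideal.Quotient.factor hle) ⟨n, ?_⟩ G₁ G₂ ?_
    · rw [Ideal.zero_eq_bot, ← le_bot_iff, Ideal.Quotient.factor_ker hle, ← Ideal.map_pow,
        Ideal.map_quotient_self]
    · intro x
      exact (key _).trans ((hI x).trans (key _).symm)
  exact DFunLike.congr_fun this b

end Lifting

theorem natCast_pIdeal (Z : RootSystem) (p m : ℕ+) :
    (((p : ℕ) : ℕ) : Ext (σ := σ) R Z m ⧸ pIdeal (σ := σ) R Z p m) = 0 := by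
  rw [← map_natCast (Ideal.Quotient.mk (pIdeal (σ := σ) R Z p m)),
    Ideal.Quotient.eq_zero_iff_mem]
  exact Ideal.mem_span_singleton_self _

/-- The ring homomorphism `ℤ[t] → R_m`, `t_α ↦ t_α^p`. -/
def adams (Z : RootSystem) (p m : ℕ+) : MvPolynomial σ ℤ →+* Ext (σ := σ) R Z m :=
  (algebraMap (MvPolynomial σ ℤ) (Ext (σ := σ) R Z m)).comp
    (MvPolynomial.eval₂Hom (Int.castRingHom (MvPolynomial σ ℤ))
      (fun α => MvPolynomial.X α ^ (p : ℕ)))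

theorem adams_X (Z : RootSystem) (p m : ℕ+) (α : σ) :
    adams R Z p m (MvPolynomial.X α) =
      ((1 : R) ⊗ₜ[MvPolynomial σ ℤ] (RootPoly.var Z m α : RootPoly σ Z m)) ^ ((m : ℕ) * p) := by
  have h := (Algebra.TensorProduct.includeRight (R := MvPolynomial σ ℤ) (A := R)
    (B := RootPoly σ Z m)).commutes (MvPolynomial.X α)
  rw [RootPoly.algebraMap_X, map_pow] at h
  rw [adams, RingHom.comp_apply, MvPolynomial.eval₂Hom_X', map_pow, ← h, ← pow_mul]
  rfl

theorem adams_X' (Z : RootSystem) (p m : ℕ+) (α : σ) :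
    adams R Z p m (MvPolynomial.X α) =
      (algebraMap (MvPolynomial σ ℤ) R (MvPolynomial.X α) ⊗ₜ[MvPolynomial σ ℤ]
        (1 : RootPoly σ Z m)) ^ (p : ℕ) := by
  rw [adams, RingHom.comp_apply, MvPolynomial.eval₂Hom_X', map_pow]
  rfl

theorem mvPoly_hom_ext {S : Type*} [CommRing S] {f g : MvPolynomial σ ℤ →+* S}
    (h : ∀ α, f (MvPolynomial.X α) = g (MvPolynomial.X α)) : f = g :=
  MvPolynomial.ringHom_ext (fun z => RingHom.congr_fun
    (RingHom.ext_int (f.comp MvPolynomial.C) (g.comp MvPolynomial.C)) z) h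

/-- A `p`-Frobenius exists and is unique, since `R` is étale over `ℤ[t]`. -/
theorem existsUnique_isFrobenius [Algebra.Etale (MvPolynomial σ ℤ) R] (Z : RootSystem)
    {p : ℕ+} (hp : Nat.Prime p) (m : ℕ+) :
    ∃! φ : Ext (σ := σ) R Z m →+* ExtHat (σ := σ) R Z p m, IsFrobenius R Z p m φ := by
  have h0 := natCast_pIdeal (σ := σ) R Z p m
  let f : R →+* Ext (σ := σ) R Z m ⧸ pIdeal (σ := σ) R Z p m :=
    (powHom hp h0).comp ((Ideal.Quotient.mk _).comp
      (Algebra.TensorProduct.includeLeftRingHom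
        (R := MvPolynomial σ ℤ) (A := R) (B := RootPoly σ Z m)))
  obtain ⟨g, hg1, hg2⟩ := exists_lift_completion (pIdeal (σ := σ) R Z p m) (adams R Z p m) f (by
    refine mvPoly_hom_ext fun α => ?_
    rw [RingHom.comp_apply, RingHom.comp_apply (Ideal.Quotient.mk _), adams_X', map_pow]
    rfl)
  let incR : RootPoly σ Z m →+* ExtHat (σ := σ) R Z p m :=
    (algebraMap _ _).comp (Algebra.TensorProduct.includeRight
      (R := MvPolynomial σ ℤ) (A := R) (B := RootPoly σ Z m) :
        RootPoly σ Z m →+* Ext (σ := σ) R Z m)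
  let h : RootPoly σ Z m →+* ExtHat (σ := σ) R Z p m :=
    RootPoly.lift (incR.comp (RootPoly.const Z m))
      (fun α => incR (RootPoly.var Z m α) ^ (p : ℕ))
  have hgh : g.comp (algebraMap (MvPolynomial σ ℤ) R) =
      h.comp (algebraMap (MvPolynomial σ ℤ) (RootPoly σ Z m)) := by
    rw [hg2]
    refine mvPoly_hom_ext fun α => ?_
    rw [RingHom.comp_apply, RingHom.comp_apply, adams_X, RootPoly.algebraMap_X, map_pow]
    simp only [h]
    rw [map_pow (RootPoly.lift _ _), RootPoly.lift_var, ← pow_mul, mul_comm]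
    rfl
  refine ⟨tensorLift g h hgh, ⟨fun z => ?_, fun α => ?_, fun r => ?_⟩, fun φ hφ => ?_⟩
  · rw [tensorLift_tmul, map_one, one_mul]
    simp only [h, RootPoly.lift_const]
    rfl
  · rw [tensorLift_tmul, map_one, one_mul]
    simp only [h, RootPoly.lift_var]
    rfl
  · rw [tensorLift_tmul, map_one, mul_one, hg1]
    rfl
  · have hR : φ.comp (Algebra.TensorProduct.includeRight
        (R := MvPolynomial σ ℤ) (A := R) (B := RootPoly σ Z m) :
          RootPoly σ Z m →+* Ext (σ := σ) R Z m) = h := by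
      refine RootPoly.hom_ext (fun z => ?_) (fun α => ?_)
      · refine (hφ.map_const z).trans ?_
        simp only [h, RootPoly.lift_const]
        rfl
      · refine (hφ.map_var α).trans ?_
        simp only [h, RootPoly.lift_var]
        rfl
    have hL : φ.comp (Algebra.TensorProduct.includeLeftRingHom
        (R := MvPolynomial σ ℤ) (A := R) (B := RootPoly σ Z m)) = g := by
      refine lift_completion_unique (A := MvPolynomial σ ℤ) _ _ _ ?_ fun r => ?_
      · rw [hgh, ← hR]
        refine RingHom.ext fun a => ?_
        refine congrArg φ ?_
        exact (Algebra.TensorProduct.algebraMap_apply' (R := MvPolynomial σ ℤ) a)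
      · rw [hg1]
        exact hφ.map_mod_p r
    refine tensor_hom_ext (fun r => ?_) (fun c => ?_)
    · rw [tensorLift_tmul, map_one, mul_one, ← hL]
      rfl
    · rw [tensorLift_tmul, map_one, one_mul, ← hR]
      rfl

/-- The `p`-Frobenius `φ_p : R_m → (R_m)^∧_p`, determined by `IsFrobenius`. -/
def frobenius [Algebra.Etale (MvPolynomial σ ℤ) R] (Z : RootSystem)
    {p : ℕ+} (hp : Nat.Prime p) (m : ℕ+) :
    Ext (σ := σ) R Z m →+* ExtHat (σ := σ) R Z p m :=
  (existsUnique_isFrobenius R Z hp m).choose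

theorem isFrobenius_frobenius [Algebra.Etale (MvPolynomial σ ℤ) R] (Z : RootSystem)
    {p : ℕ+} (hp : Nat.Prime p) (m : ℕ+) : IsFrobenius (σ := σ) R Z p m (frobenius R Z hp m) :=
  (existsUnique_isFrobenius R Z hp m).choose_spec.1

/-! ## Re-expansion and the Habiro ring -/

/-- The image of `ζ_{pm} - ζ_m` in `R_{pm} / p^N`. -/
def shiftConst (Z : RootSystem) (p m : ℕ+) (N : ℕ) :
    Ext (σ := σ) R Z (p * m) ⧸ pIdeal (σ := σ) R Z p (p * m) ^ N :=
  Ideal.Quotient.mk _ (1 ⊗ₜ RootPoly.const Z (p * m) (zeta Z (p * m) - zetaIn Z p m))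

theorem root_pow_eq (Z : RootSystem) {p : ℕ+} (hp : Nat.Prime p) (m : ℕ+) :
    ∃ n : ℕ, Z.root (p * m) ^ (p : ℕ) ^ n = Z.root m ^ (p : ℕ) ^ n := by
  obtain ⟨a, k, hk, hm⟩ := Nat.exists_eq_pow_mul_and_not_dvd m.ne_zero (p : ℕ) hp.ne_one
  have hk0 : 0 < k := Nat.pos_of_ne_zero fun h => hk (h ▸ dvd_zero _)
  lift k to ℕ+ using hk0
  have hm' : m = p ^ a * k := PNat.eq (by simpa using hm)
  have hcop : ∀ b : ℕ, Nat.Coprime ((p ^ b : ℕ+) : ℕ) k := fun b => by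
    rw [PNat.pow_coe]
    exact Nat.Coprime.pow_left b ((Nat.Prime.coprime_iff_not_dvd hp).2 hk)
  refine ⟨a + 1, ?_⟩
  have h1 : Z.root m = Z.root (p ^ a) * Z.root k := by rw [hm', Z.mul_of_coprime _ _ (hcop a)]
  have h2 : Z.root (p * m) = Z.root (p ^ (a + 1)) * Z.root k := by
    rw [hm', ← mul_assoc, ← pow_succ', Z.mul_of_coprime _ _ (hcop (a + 1))]
  have e1 : Z.root (p ^ (a + 1)) ^ (p : ℕ) ^ (a + 1) = 1 := by
    have := (Z.primitive (p ^ (a + 1))).pow_eq_one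
    rwa [PNat.pow_coe] at this
  have e2 : Z.root (p ^ a) ^ (p : ℕ) ^ (a + 1) = 1 := by
    have := (Z.primitive (p ^ a)).pow_eq_one
    rw [PNat.pow_coe] at this
    rw [pow_succ, pow_mul, this, one_pow]
  rw [h1, h2, mul_pow, mul_pow, e1, e2]

/-- `ζ_{pm} - ζ_m` is nilpotent modulo every power of `p`, so that re-expansion makes sense. -/
theorem isNilpotent_shiftConst (Z : RootSystem) {p : ℕ+} (hp : Nat.Prime p) (m : ℕ+) (N : ℕ) :
    IsNilpotent (shiftConst (σ := σ) R Z p m N) := by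
  obtain ⟨n, hn⟩ := root_pow_eq Z hp m
  let c : Cyc Z (p * m) →+* Ext (σ := σ) R Z (p * m) :=
    (Algebra.TensorProduct.includeRight (R := MvPolynomial σ ℤ) (A := R)
      (B := RootPoly σ Z (p * m)) : RootPoly σ Z (p * m) →+* Ext (σ := σ) R Z (p * m)).comp (RootPoly.const Z (p * m))
  let q := (Ideal.Quotient.mk (pIdeal (σ := σ) R Z p (p * m))).comp c
  have hz : zeta Z (p * m) ^ (p : ℕ) ^ n = zetaIn Z p m ^ (p : ℕ) ^ n := Subtype.ext hn
  have hmem : c (zeta Z (p * m) - zetaIn Z p m) ^ (p : ℕ) ^ n ∈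
      pIdeal (σ := σ) R Z p (p * m) := by
    rw [← Ideal.Quotient.eq_zero_iff_mem, map_pow]
    change q (zeta Z (p * m) - zetaIn Z p m) ^ (p : ℕ) ^ n = 0
    rw [map_sub, sub_pow_pow hp (natCast_pIdeal (σ := σ) R Z p (p * m)), ← map_pow, ← map_pow, hz,
      sub_self]
  refine ⟨(p : ℕ) ^ n * N, ?_⟩
  change Ideal.Quotient.mk _ (c (zeta Z (p * m) - zetaIn Z p m)) ^ ((p : ℕ) ^ n * N) = 0
  rw [← map_pow, Ideal.Quotient.eq_zero_iff_mem, pow_mul]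
  exact Ideal.pow_mem_pow hmem N

theorem hasSubst_shift (Z : RootSystem) {p : ℕ+} (hp : Nat.Prime p) (m : ℕ+) (N : ℕ) :
    PowerSeries.HasSubst
      (PowerSeries.X + PowerSeries.C (shiftConst (σ := σ) R Z p m N) : PowerSeries _) := by
  have h := isNilpotent_shiftConst (σ := σ) R Z hp m N
  change IsNilpotent (PowerSeries.constantCoeff _)
  simpa using h

/-- Collections `(f_m(q - ζ_m))_{m ≥ 1}` in `∏_m R_m⟦q - ζ_m⟧`; the variable `X` of the `m`-th
component is `q - ζ_m`. -/
abbrev Family (σ : Type*) (R : Type*) [CommRing R] [Algebra (MvPolynomial σ ℤ) R]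
    (Z : RootSystem) : Type _ :=
  ∀ m : ℕ+, PowerSeries (Ext (σ := σ) R Z m)

/-- The re-expansion `f_m(q - ζ_{pm} + (ζ_{pm} - ζ_m))` modulo `p^N`, as a power series in
`X = q - ζ_{pm}` over `R_{pm} / p^N = (R_{pm})^∧_p / p^N`. -/
def reexpand (Z : RootSystem) {p : ℕ+} (hp : Nat.Prime p) (m : ℕ+) (N : ℕ) :
    Family σ R Z →+*
      PowerSeries (Ext (σ := σ) R Z (p * m) ⧸ pIdeal (σ := σ) R Z p (p * m) ^ N) :=
  ((PowerSeries.substAlgHom (hasSubst_shift (σ := σ) R Z hp m N)).toRingHom.comp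
    (PowerSeries.map ((Ideal.Quotient.mk (pIdeal (σ := σ) R Z p (p * m) ^ N)).comp (Ext.incl (σ := σ) R Z p m)))).comp
    (Pi.evalRingHom _ m)

/-- The Frobenius twist `φ_p f_{pm}(q - ζ_{pm})` modulo `p^N`, as a power series in
`X = q - ζ_{pm}` over `R_{pm} / p^N = (R_{pm})^∧_p / p^N`; `φ_p` acts on coefficients. -/
def twist [Algebra.Etale (MvPolynomial σ ℤ) R] (Z : RootSystem) {p : ℕ+} (hp : Nat.Prime p)
    (m : ℕ+) (N : ℕ) :
    Family σ R Z →+*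
      PowerSeries (Ext (σ := σ) R Z (p * m) ⧸ pIdeal (σ := σ) R Z p (p * m) ^ N) :=
  (PowerSeries.map
    ((AdicCompletion.evalₐ (pIdeal (σ := σ) R Z p (p * m)) N : _ →+* _).comp
      (frobenius (σ := σ) R Z hp (p * m)))).comp
    (Pi.evalRingHom _ (p * m))

/-- The Habiro ring `H_{R/ℤ[t]}` of an étale `ℤ[t]`-algebra `R`: the collections
`(f_m(q - ζ_m))_m` with `f_m(q - ζ_{pm} + (ζ_{pm} - ζ_m)) = φ_p f_{pm}(q - ζ_{pm})` in
`(R_{pm})^∧_p⟦q - ζ_{pm}⟧` for all `m ≥ 1` and all primes `p`. Equality over the `p`-adic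
completion `lim_N R_{pm}/p^N` is equality modulo `p^N` for every `N`. -/
def habiroRing (σ : Type*) (R : Type*) [CommRing R] [Algebra (MvPolynomial σ ℤ) R]
    [Algebra.Etale (MvPolynomial σ ℤ) R] (Z : RootSystem) : Subring (Family σ R Z) :=
  ⨅ (m : ℕ+) (p : ℕ+) (hp : Nat.Prime p) (N : ℕ),
    RingHom.eqLocus (reexpand R Z hp m N) (twist R Z hp m N)

/-! ## The rational function `f_{𝒜,Q}(t)` and the ring `ℤ[t][f_{𝒜,Q}(t)]` -/

section Series

/-- The embedding of `ℤ[ζ_m][t^{1/m}]` in the power series ring `ℤ[ζ_m]⟦t^{1/m}⟧`. -/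
def RootPoly.toSeries (σ : Type*) (Z : RootSystem) (m : ℕ+) :
    RootPoly σ Z m →+* MvPowerSeries σ (Cyc Z m) :=
  (MvPolynomial.coeToMvPowerSeries.ringHom : MvPolynomial σ (Cyc Z m) →+* _)

theorem RootPoly.toSeries_var (Z : RootSystem) (m : ℕ+) (α : σ) :
    RootPoly.toSeries σ Z m (RootPoly.var Z m α) = MvPowerSeries.X α :=
  MvPolynomial.coe_X α

theorem two_dvd_sum_sub_diag (g : σ → σ → ℤ) (hg : ∀ α β, g α β = g β α) (s : Finset σ) :
    2 ∣ ∑ α ∈ s, ∑ β ∈ s, g α β - ∑ α ∈ s, g α α := by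
  classical
  induction s using Finset.induction_on with
  | empty => simp
  | insert a s ha ih =>
    have h : ∑ α ∈ s, g α a = ∑ α ∈ s, g a α := Finset.sum_congr rfl fun α _ => hg α a
    simp only [Finset.sum_insert ha, Finset.sum_add_distrib, h]
    obtain ⟨c, hc⟩ := ih
    exact ⟨∑ α ∈ s, g a α + c, by linear_combination hc⟩

variable [Fintype σ] (Q : Matrix σ σ ℤ)

/-- The polynomial `1 - ∑_α (-1)^{Q_αα} t_α`, whose inverse is `f_{𝒜,Q}(t)`. -/
def denom : MvPolynomial σ ℤ :=
  1 - ∑ α, MvPolynomial.C ((Q α α).negOnePow : ℤ) * MvPolynomial.X α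

/-- The ring `ℤ[t][f_{𝒜,Q}(t)] = ℤ[t][1 / (1 - ∑_α (-1)^{Q_αα} t_α)]`. -/
abbrev RatRing : Type _ := Localization.Away (denom Q)

theorem isUnit_denom (Z : RootSystem) (m : ℕ+) :
    IsUnit (((RootPoly.toSeries σ Z m).comp
      (algebraMap (MvPolynomial σ ℤ) (RootPoly σ Z m))) (denom Q)) := by
  rw [MvPowerSeries.isUnit_iff_constantCoeff]
  suffices h : MvPowerSeries.constantCoeff (((RootPoly.toSeries σ Z m).comp
      (algebraMap (MvPolynomial σ ℤ) (RootPoly σ Z m))) (denom Q)) = 1 by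
    rw [h]; exact isUnit_one
  rw [denom, map_sub, map_one, map_sum, map_sub, map_one, map_sum, sub_eq_self]
  refine Finset.sum_eq_zero fun α _ => ?_
  rw [map_mul, map_mul, RingHom.comp_apply _ _ (MvPolynomial.X α), RootPoly.algebraMap_X, map_pow,
    RootPoly.toSeries_var, map_pow, MvPowerSeries.constantCoeff_X, zero_pow m.ne_zero, mul_zero]

/-- The expansion at `t = 0` of elements of `R_m`, for `R = ℤ[t][f_{𝒜,Q}(t)]`: the ring
homomorphism `R_m → ℤ[ζ_m]⟦t^{1/m}⟧` extending `ℤ[ζ_m][t^{1/m}] ⊆ ℤ[ζ_m]⟦t^{1/m}⟧`. -/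
def expand (Z : RootSystem) (m : ℕ+) :
    Ext (σ := σ) (RatRing Q) Z m →+* MvPowerSeries σ (Cyc Z m) :=
  tensorLift (IsLocalization.Away.lift (denom Q) (isUnit_denom Q Z m)) (RootPoly.toSeries σ Z m)
    (IsLocalization.Away.lift_comp (denom Q) (isUnit_denom Q Z m))

/-! ## The series `f_{𝒜,Q}(t,q)` -/

/-- The `q`-Pochhammer symbol `(q;q)_n = (1-q)(1-q²)⋯(1-qⁿ)`, with `q` the variable of `ℤ[X]`. -/
def qPoch (n : ℕ) : ℤ[X] := ∏ i ∈ Finset.range n, (1 - Polynomial.X ^ (i + 1))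

theorem qPoch_succ (n : ℕ) : qPoch (n + 1) = qPoch n * (1 - Polynomial.X ^ (n + 1)) :=
  Finset.prod_range_succ _ _

theorem qPoch_mul_dvd (a b : ℕ) : qPoch a * qPoch b ∣ qPoch (a + b) := by
  induction h : a + b generalizing a b with
  | zero =>
    obtain ⟨rfl, rfl⟩ : a = 0 ∧ b = 0 := by omega
    simp [qPoch]
  | succ n ih =>
    rcases a with _ | a
    · obtain rfl : b = n + 1 := by omega
      simp [qPoch]
    rcases b with _ | b
    · obtain rfl : a = n := by omega
      simp [qPoch]
    have h1 := ih a (b + 1) (by omega)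
    have h2 := ih (a + 1) b (by omega)
    have e : (1 - Polynomial.X ^ (n + 1) : ℤ[X]) =
        (1 - Polynomial.X ^ (a + 1)) + Polynomial.X ^ (a + 1) * (1 - Polynomial.X ^ (b + 1)) := by
      have : n + 1 = (a + 1) + (b + 1) := by omega
      rw [this]; ring
    rw [qPoch_succ n, e, mul_add]
    refine dvd_add ?_ ?_
    · rw [qPoch_succ a, mul_right_comm]
      exact mul_dvd_mul_right h1 _
    · rw [qPoch_succ b, ← mul_assoc, ← mul_assoc]
      exact mul_dvd_mul_right (h2.mul_right _) _

theorem prod_qPoch_dvd (k : σ →₀ ℕ) : ∏ α, qPoch (k α) ∣ qPoch (∑ α, k α) := by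
  classical
  suffices h : ∀ s : Finset σ, ∏ α ∈ s, qPoch (k α) ∣ qPoch (∑ α ∈ s, k α) from h _
  intro s
  induction s using Finset.induction_on with
  | empty => simp
  | insert a s ha ih =>
    rw [Finset.prod_insert ha, Finset.sum_insert ha]
    exact (mul_dvd_mul_left _ ih).trans (qPoch_mul_dvd _ _)

/-- The `q`-multinomial coefficient `(q;q)_{∑ k_α} / ∏_α (q;q)_{k_α} ∈ ℤ[q]`. -/
def qMultinomial (k : σ →₀ ℕ) : ℤ[X] := (prod_qPoch_dvd k).choose

/-- The defining property of the `q`-multinomial coefficient. -/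
theorem qMultinomial_spec (k : σ →₀ ℕ) :
    qPoch (∑ α, k α) = (∏ α, qPoch (k α)) * qMultinomial k :=
  (prod_qPoch_dvd k).choose_spec

/-- `diag(Q) k = ∑_α Q_αα k_α`. -/
def diagDot (k : σ →₀ ℕ) : ℤ := ∑ α, Q α α * k α

/-- The exponent `½ kᵗ Q k + ½ diag(Q) k`; for symmetric `Q` the division by `2` is exact, see
`two_mul_qExponent`. -/
def qExponent (k : σ →₀ ℕ) : ℤ := ((∑ α, ∑ β, k α * Q α β * k β) + diagDot Q k) / 2

theorem two_mul_qExponent (hQ : Q.IsSymm) (k : σ →₀ ℕ) :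
    2 * qExponent Q k = (∑ α, ∑ β, k α * Q α β * k β) + diagDot Q k := by
  refine Int.mul_ediv_cancel' ?_
  have h1 := two_dvd_sum_sub_diag (fun α β => (k α : ℤ) * Q α β * k β)
    (fun α β => by rw [← hQ.apply α β]; ring) Finset.univ
  have h2 : (2 : ℤ) ∣ ∑ α, ((k α : ℤ) * Q α α * k α + Q α α * k α) :=
    Finset.dvd_sum fun α _ => by
      have : (k α : ℤ) * Q α α * k α + Q α α * k α = Q α α * (k α * (k α + 1)) := by ring
      rw [this]
      exact (Int.even_mul_succ_self _).two_dvd.mul_left _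
  have h3 := dvd_add h1 h2
  rw [Finset.sum_add_distrib] at h3
  obtain ⟨c, hc⟩ := h3
  exact ⟨c, by rw [diagDot]; linear_combination hc⟩

/-- The series `f_{𝒜,Q}(t,q) = ∑_k (-1)^{diag(Q)k} q^{½kᵗQk + ½diag(Q)k}
(q;q)_{∑ k_α} / ∏ (q;q)_{k_α} ∏ t_α^{k_α}`, a power series in `t` over `ℤ[q, q⁻¹]`. -/
def qSeries : MvPowerSeries σ ℤ[T;T⁻¹] := fun k =>
  LaurentPolynomial.C ((diagDot Q k).negOnePow : ℤ) * LaurentPolynomial.T (qExponent Q k) *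
    Polynomial.toLaurent (qMultinomial k)

theorem isUnit_q (Z : RootSystem) (m : ℕ+) :
    IsUnit (PowerSeries.C (zeta Z m) + PowerSeries.X : PowerSeries (Cyc Z m)) := by
  rw [PowerSeries.isUnit_iff_constantCoeff]
  have h : zeta Z m ^ (m : ℕ) = 1 := Subtype.ext (Z.primitive m).pow_eq_one
  simpa using IsUnit.of_pow_eq_one h m.ne_zero

/-- Expansion of Laurent polynomials in `q` at `q = ζ_m`: the map `ℤ[q, q⁻¹] → ℤ[ζ_m]⟦X⟧`,
`q ↦ ζ_m + X`, so that `X = q - ζ_m`. -/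
def laurentAt (Z : RootSystem) (m : ℕ+) : ℤ[T;T⁻¹] →+* PowerSeries (Cyc Z m) :=
  LaurentPolynomial.eval₂ (Int.castRingHom _) (isUnit_q Z m).unit

/-- The collection `F = (f_m)_m` is given by `f ∈ ℤ[q, q⁻¹]⟦t⟧`: for every `m`, the element
`f_m ∈ R_m⟦q - ζ_m⟧` is the expansion of `f(t^{1/m}, q)` at `q = ζ_m`, that is, the coefficients
of `∏_α (t_α^{1/m})^{k_α} (q - ζ_m)^n` in both agree for all `k` and `n`. -/
def IsExpansion (Z : RootSystem) (f : MvPowerSeries σ ℤ[T;T⁻¹])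
    (F : Family σ (RatRing Q) Z) : Prop :=
  ∀ (m : ℕ+) (k : σ →₀ ℕ) (n : ℕ),
    MvPowerSeries.coeff k (expand Q Z m (PowerSeries.coeff n (F m))) =
      PowerSeries.coeff n (laurentAt Z m (MvPowerSeries.coeff k f))

end Series

end Habiro

end

/-! The series satisfies a first-order `q`-difference equation `f = 1 + ∑_α (-1)^{Q_αα} (t_α
f)(q^{c_α} t)` with `c_αβ = Q_αβ + [β < α]` for an auxiliary order on the index set
(`coeff_qSeries`). Put `q = ζ_m + X` and `f = ∑ f_n X^n`. The equation becomes `(1 - L) f_n = `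
(terms built from `f_j` with `j < n`), where `L` is the sum of the operators `g ↦ (-1)^{Q_αα} (s_α
g)(ζ_m^{c_α} s)`. Because of the term `[β < α]`, these summands `ζ_m`-commute, so the `q`-binomial
theorem at a primitive `m`-th root of unity makes `L^m` the sum of their `m`-th powers, which is
multiplication by `∑_α (-1)^{Q_αα} s_α^m` (`stepOp_pow`). Hence `(1 + L + ⋯ + L^{m-1})(1 - L) = 1 -
L^m` is multiplication by the denominator of `f_{𝒜,Q}(t)` at `t_α = s_α^m`, and induction on `n`
shows that every `f_n` is a polynomial divided by a power of it (`mem_ratSeries_of_recurrence`), so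
it comes from `R_m`.

For the gluing, expansion at `t = 0` stays injective modulo `p^N` (`expandMod_injective`), so the
condition may be tested on power series. There both the inclusion `R_m → R_{pm}` and the Frobenius
on `R_{pm}` become `s ↦ s^p`. At `s^{pj}` the two sides are then the expansion at `ζ_m` of one
Laurent polynomial, re-expanded at `ζ_{pm}`, and its direct expansion at `ζ_{pm}`; these agree
(`subst_laurentAt`). Injectivity also gives uniqueness. -/

noncomputable section

namespace Habiro

/-! ### Gaussian binomials and powers of sums of `q`-commuting elements. -/

section QBinomial

variable {K : Type*} [CommRing K]

/-- The Gaussian binomial coefficient at `q`. -/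
def gaussBinom (q : K) : ℕ → ℕ → K
  | _, 0 => 1
  | 0, _ + 1 => 0
  | n + 1, i + 1 => gaussBinom q n i + q ^ (i + 1) * gaussBinom q n (i + 1)

@[simp] theorem gaussBinom_zero_right (q : K) (n : ℕ) : gaussBinom q n 0 = 1 := by
  cases n <;> rfl

theorem gaussBinom_succ_succ (q : K) (n i : ℕ) : gaussBinom q (n + 1) (i + 1) =
    gaussBinom q n i + q ^ (i + 1) * gaussBinom q n (i + 1) := rfl

theorem gaussBinom_eq_zero (q : K) {n i : ℕ} (h : n < i) : gaussBinom q n i = 0 := by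
  induction n generalizing i with
  | zero => obtain ⟨i, rfl⟩ := Nat.exists_eq_succ_of_ne_zero h.ne'; rfl
  | succ n ih =>
    obtain ⟨i, rfl⟩ := Nat.exists_eq_succ_of_ne_zero (Nat.ne_zero_of_lt h)
    rw [Nat.succ_eq_add_one, gaussBinom_succ_succ, ih (by omega), ih (by omega)]; ring

@[simp] theorem gaussBinom_self (q : K) (n : ℕ) : gaussBinom q n n = 1 := by
  induction n with
  | zero => rfl
  | succ n ih => rw [gaussBinom_succ_succ, ih, gaussBinom_eq_zero q n.lt_succ_self]; ring

/-- The ratio of neighbouring Gaussian binomials, cleared of denominators because `1 - q^i` may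
vanish at a root of unity. -/
theorem gaussBinom_succ_right (q : K) (n i j : ℕ) (h : i + j = n) :
    (1 - q ^ (i + 1)) * gaussBinom q n (i + 1) = (1 - q ^ j) * gaussBinom q n i := by
  induction n generalizing i j with
  | zero =>
    obtain ⟨rfl, rfl⟩ : i = 0 ∧ j = 0 := by omega
    simp [gaussBinom]
  | succ n ih =>
    have absorb : ∀ i j, i + j = n → (1 - q ^ (i + 1)) * gaussBinom q (n + 1) (i + 1) =
        (1 - q ^ (n + 1)) * gaussBinom q n i := fun i j hij => by
      rw [gaussBinom_succ_succ]
      have := ih i j hij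
      subst hij
      linear_combination q ^ (i + 1) * this
    rcases j with _ | j
    · obtain rfl : i = n + 1 := by omega
      rw [gaussBinom_eq_zero q (Nat.lt_succ_self _)]; simp
    rw [absorb i j (by omega)]
    rcases i with _ | i
    · obtain rfl : j = n := by omega
      simp
    have := ih i (j + 1) (by omega)
    rw [gaussBinom_succ_succ]
    obtain rfl : n = i + (j + 1) := by omega
    linear_combination this

theorem gaussBinom_absorb (q : K) {n i : ℕ} (h : i ≤ n) :
    (1 - q ^ (i + 1)) * gaussBinom q (n + 1) (i + 1) = (1 - q ^ (n + 1)) * gaussBinom q n i := by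
  obtain ⟨j, rfl⟩ := Nat.exists_eq_add_of_le h
  rw [gaussBinom_succ_succ]
  linear_combination q ^ (i + 1) * gaussBinom_succ_right q _ i j rfl

/-- In the absorption identity the factor `1 - q^m` vanishes while `1 - q^i` does not. -/
theorem gaussBinom_primitiveRoot [IsDomain K] {q : K} {m i : ℕ} (hq : IsPrimitiveRoot q m)
    (h0 : 0 < i) (hm : i < m) : gaussBinom q m i = 0 := by
  obtain ⟨m, rfl⟩ := Nat.exists_eq_succ_of_ne_zero (Nat.ne_zero_of_lt hm)
  obtain ⟨i, rfl⟩ := Nat.exists_eq_succ_of_ne_zero h0.ne'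
  have := gaussBinom_absorb q (show i ≤ m by omega)
  rw [hq.pow_eq_one, sub_self, zero_mul] at this
  refine (mul_eq_zero.1 this).resolve_left fun h => ?_
  exact hq.pow_ne_one_of_pos_of_lt (by omega) hm (sub_eq_zero.1 h).symm

variable {E : Type*} [Ring E] [Algebra K E]

theorem mul_pow_of_qcommute (q : K) {a b : E} (h : a * b = q • (b * a)) (j : ℕ) :
    a * b ^ j = q ^ j • (b ^ j * a) := by
  induction j with
  | zero => simp
  | succ j ih =>
    rw [pow_succ, ← mul_assoc, ih, smul_mul_assoc, mul_assoc, h, mul_smul_comm, smul_smul,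
      ← mul_assoc, pow_succ]

/-- The `q`-binomial theorem for `q`-commuting elements. -/
theorem add_pow_of_qcommute (q : K) {a b : E} (h : a * b = q • (b * a)) (n : ℕ) :
    (a + b) ^ n = ∑ ij ∈ Finset.HasAntidiagonal.antidiagonal n, gaussBinom q n ij.1 • (b ^ ij.1 * a ^ ij.2) := by
  induction n with
  | zero => simp
  | succ n ih =>
    rw [pow_succ', ih, add_mul, Finset.Nat.sum_antidiagonal_succ]
    simp only [gaussBinom_succ_succ, add_smul, Finset.sum_add_distrib]
    have h1 : a * ∑ ij ∈ Finset.HasAntidiagonal.antidiagonal n, gaussBinom q n ij.1 • (b ^ ij.1 * a ^ ij.2) =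
        ∑ ij ∈ Finset.HasAntidiagonal.antidiagonal n,
          (q ^ ij.1 * gaussBinom q n ij.1) • (b ^ ij.1 * a ^ (ij.2 + 1)) := by
      rw [Finset.mul_sum]
      refine Finset.sum_congr rfl fun ij _ => ?_
      rw [mul_smul_comm, ← mul_assoc, mul_pow_of_qcommute q h, smul_mul_assoc, smul_smul,
        mul_assoc, ← pow_succ', mul_comm]
    have h2 : b * ∑ ij ∈ Finset.HasAntidiagonal.antidiagonal n, gaussBinom q n ij.1 • (b ^ ij.1 * a ^ ij.2) =
        ∑ ij ∈ Finset.HasAntidiagonal.antidiagonal n, gaussBinom q n ij.1 • (b ^ (ij.1 + 1) * a ^ ij.2) := by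
      rw [Finset.mul_sum]
      refine Finset.sum_congr rfl fun ij _ => ?_
      rw [mul_smul_comm, ← mul_assoc, ← pow_succ']
    -- Splitting one sum over the antidiagonal of `n + 1` at either end shifts the index; the extra
    -- top term is zero since the binomial of `n` over `n + 1` vanishes.
    have h3 := Finset.Nat.sum_antidiagonal_succ (n := n)
      (f := fun ij => (q ^ ij.1 * gaussBinom q n ij.1) • (b ^ ij.1 * a ^ ij.2))
    rw [Finset.Nat.sum_antidiagonal_succ'] at h3
    simp only [gaussBinom_eq_zero q n.lt_succ_self, mul_zero, zero_smul, zero_add, pow_zero,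
      one_mul, gaussBinom_zero_right, one_smul] at h3
    rw [h1, h2]
    simp only [gaussBinom_zero_right, pow_zero, one_mul, one_smul]
    rw [add_left_comm, ← h3, add_comm]

/-- A characteristic-free analogue of additivity of the `p`-th power: all inner `q`-binomials
vanish. -/
theorem add_pow_of_qcommute_primitiveRoot [IsDomain K] {q : K} {m : ℕ} (hm : 0 < m)
    (hq : IsPrimitiveRoot q m) {a b : E} (h : a * b = q • (b * a)) :
    (a + b) ^ m = a ^ m + b ^ m := by
  rw [add_pow_of_qcommute q h, Finset.sum_eq_add_of_mem (0, m) (m, 0)]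
  · simp
  · simp
  · simp
  · simp [hm.ne']
  · rintro ⟨i, j⟩ hij hne
    rw [Finset.HasAntidiagonal.mem_antidiagonal] at hij
    simp only [ne_eq, Prod.mk.injEq, not_and] at hne hij
    rw [gaussBinom_primitiveRoot hq (by grind) (by grind), zero_smul]

theorem sum_pow_of_qcommute_primitiveRoot [IsDomain K] {q : K} {m : ℕ} (hm : 0 < m)
    (hq : IsPrimitiveRoot q m) {ι : Type*} [LinearOrder ι] (y : ι → E)
    (h : ∀ i j, j < i → y i * y j = q • (y j * y i)) (s : Finset ι) :
    (∑ i ∈ s, y i) ^ m = ∑ i ∈ s, y i ^ m := by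
  -- Adjoining the largest index keeps the relation uniform: `y a` passes every earlier term, hence
  -- their sum, at the cost of the same factor `q`.
  induction s using Finset.induction_on_max with
  | empty => simp [hm.ne']
  | insert a s ha ih =>
    have has : a ∉ s := fun h => (ha a h).false
    rw [Finset.sum_insert has, Finset.sum_insert has, ← ih]
    refine add_pow_of_qcommute_primitiveRoot hm hq ?_
    rw [Finset.mul_sum, Finset.sum_mul, Finset.smul_sum]
    exact Finset.sum_congr rfl fun i hi => h a i (ha i hi)

end QBinomial

/-! ### Power series with a fixed denominator, and operators diagonal on monomials. -/

section Rational

variable {σ : Type*} {K : Type*} [CommRing K]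

/-- The power series `g` with `d ^ M * g` a polynomial for some `M`. -/
def ratSeries (d : MvPolynomial σ K) : Submodule K (MvPowerSeries σ K) where
  carrier := {g | ∃ (M : ℕ) (p : MvPolynomial σ K),
    (d : MvPowerSeries σ K) ^ M * g = (p : MvPowerSeries σ K)}
  zero_mem' := ⟨0, 0, by simp⟩
  add_mem' := by
    rintro g h ⟨M, p, hp⟩ ⟨N, r, hr⟩
    refine ⟨M + N, d ^ N * p + d ^ M * r, ?_⟩
    push_cast
    rw [← hp, ← hr]
    ring
  smul_mem' := by
    rintro c g ⟨M, p, hp⟩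
    refine ⟨M, c • p, ?_⟩
    rw [mul_smul_comm, hp, MvPolynomial.coe_smul]

variable {d : MvPolynomial σ K}

theorem coe_mem_ratSeries (p : MvPolynomial σ K) : (p : MvPowerSeries σ K) ∈ ratSeries d :=
  ⟨0, p, by simp⟩

theorem mul_mem_ratSeries (r : MvPolynomial σ K) {g : MvPowerSeries σ K} (hg : g ∈ ratSeries d) :
    (r : MvPowerSeries σ K) * g ∈ ratSeries d := by
  obtain ⟨M, p, hp⟩ := hg
  exact ⟨M, r * p, by push_cast; rw [← hp]; ring⟩

theorem mem_ratSeries_of_mul_mem {g : MvPowerSeries σ K}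
    (hg : (d : MvPowerSeries σ K) * g ∈ ratSeries d) : g ∈ ratSeries d := by
  obtain ⟨M, p, hp⟩ := hg
  exact ⟨M + 1, p, by rw [← hp]; ring⟩

/-- The operator multiplying the coefficient of `s^k` by `w k`. -/
def diagOp (w : (σ →₀ ℕ) → K) : MvPowerSeries σ K →ₗ[K] MvPowerSeries σ K where
  toFun g := fun k => w k * MvPowerSeries.coeff k g
  map_add' g h := by
    ext k
    change w k * _ = w k * _ + w k * _
    rw [map_add, mul_add]
  map_smul' c g := by
    ext k
    change w k * _ = c * (w k * _)
    rw [map_smul, smul_eq_mul]; ring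

@[simp] theorem coeff_diagOp (w : (σ →₀ ℕ) → K) (g : MvPowerSeries σ K) (k : σ →₀ ℕ) :
    MvPowerSeries.coeff k (diagOp w g) = w k * MvPowerSeries.coeff k g := rfl

theorem exists_coe_of_finite {g : MvPowerSeries σ K}
    (h : {k | MvPowerSeries.coeff k g ≠ 0}.Finite) :
    ∃ p : MvPolynomial σ K, (p : MvPowerSeries σ K) = g := by
  classical
  refine ⟨∑ k ∈ h.toFinset, MvPolynomial.monomial k (MvPowerSeries.coeff k g), ?_⟩
  ext k
  rw [MvPolynomial.coeff_coe, MvPolynomial.coeff_sum]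
  simp only [MvPolynomial.coeff_monomial]
  rw [Finset.sum_ite_eq']
  split_ifs with hk
  · rfl
  · simpa [eq_comm] using hk

theorem diagOp_coe (w : (σ →₀ ℕ) → K) (p : MvPolynomial σ K) :
    ∃ r : MvPolynomial σ K, (r : MvPowerSeries σ K) = diagOp w p := by
  refine exists_coe_of_finite (p.support.finite_toSet.subset fun k hk => ?_)
  rw [Finset.mem_coe, MvPolynomial.mem_support_iff]
  intro h
  exact hk (by rw [coeff_diagOp, MvPolynomial.coeff_coe, h, mul_zero])

/-- A Leibniz rule: scaling monomials by a multiplicative `χ` respects products, and taking the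
`n`-th coefficient of `χ` turns this into a convolution. -/
theorem diagOp_mul_antidiagonal {χ : (σ →₀ ℕ) → PowerSeries K}
    (hχ : ∀ k l, χ (k + l) = χ k * χ l) (n : ℕ) (g h : MvPowerSeries σ K) :
    diagOp (fun k => PowerSeries.coeff n (χ k)) (g * h) =
      ∑ ij ∈ Finset.HasAntidiagonal.antidiagonal n,
        diagOp (fun k => PowerSeries.coeff ij.1 (χ k)) g *
          diagOp (fun k => PowerSeries.coeff ij.2 (χ k)) h := by
  classical
  ext k
  rw [coeff_diagOp, map_sum, MvPowerSeries.coeff_mul, Finset.mul_sum]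
  simp only [MvPowerSeries.coeff_mul, coeff_diagOp]
  rw [Finset.sum_comm]
  refine Finset.sum_congr rfl fun x hx => ?_
  rw [Finset.HasAntidiagonal.mem_antidiagonal] at hx
  rw [← hx, hχ, PowerSeries.coeff_mul, Finset.sum_mul]
  exact Finset.sum_congr rfl fun _ _ => by ring

/-- Coefficients of a multiplicative character preserve rationality when the leading one fixes
the denominator. -/
theorem diagOp_mem_ratSeries {χ : (σ →₀ ℕ) → PowerSeries K}
    (hχ : ∀ k l, χ (k + l) = χ k * χ l)
    (hd : diagOp (fun k => PowerSeries.coeff 0 (χ k)) (d : MvPowerSeries σ K) = d)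
    (n : ℕ) {g : MvPowerSeries σ K} (hg : g ∈ ratSeries d) :
    diagOp (fun k => PowerSeries.coeff n (χ k)) g ∈ ratSeries d := by
  induction n using Nat.strong_induction_on generalizing g with
  | _ n ihn =>
    obtain ⟨M, p, hp⟩ := hg
    induction M generalizing g with
    | zero =>
      obtain ⟨r, hr⟩ := diagOp_coe (fun k => PowerSeries.coeff n (χ k)) p
      rw [pow_zero, one_mul] at hp
      rw [hp, ← hr]
      exact coe_mem_ratSeries r
    | succ M ihM =>
      have hdg : (d : MvPowerSeries σ K) ^ M * (d * g) = p := by rw [← hp]; ring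
      have h1 := ihM hdg
      -- The Leibniz rule for `d * g` has leading term `d` times the wanted series, as the zeroth
      -- operator fixes `d`; the other terms apply operators of index below `n` to `g`.
      rw [diagOp_mul_antidiagonal hχ, ← Finset.add_sum_erase _ _
        (show (0, n) ∈ Finset.HasAntidiagonal.antidiagonal n by simp), hd] at h1
      refine mem_ratSeries_of_mul_mem ((Submodule.add_mem_iff_left _ ?_).1 h1)
      refine Submodule.sum_mem _ fun ij hij => ?_
      obtain ⟨r, hr⟩ := diagOp_coe (fun k => PowerSeries.coeff ij.1 (χ k)) d
      rw [← hr]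
      refine mul_mem_ratSeries r (ihn _ ?_ ⟨M + 1, p, hp⟩)
      rw [Finset.mem_erase, Finset.HasAntidiagonal.mem_antidiagonal] at hij
      obtain ⟨h2, h3⟩ := hij
      have : ij.1 ≠ 0 := fun h => h2 (by ext <;> simp <;> omega)
      omega

/-- The operator `g ↦ χ(s · g)` attached to a variable and a character `χ`. -/
def shiftOp (χ : (σ →₀ ℕ) → K) (α : σ) : Module.End K (MvPowerSeries σ K) :=
  diagOp χ ∘ₗ LinearMap.mulLeft K (MvPowerSeries.X α)

theorem shiftOp_apply (χ : (σ →₀ ℕ) → K) (α : σ) (g : MvPowerSeries σ K) :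
    shiftOp χ α g = diagOp χ (MvPowerSeries.X α * g) := rfl

theorem diagOp_X_mul {χ : (σ →₀ ℕ) → K} (hχ : ∀ k l, χ (k + l) = χ k * χ l) (α : σ)
    (g : MvPowerSeries σ K) : diagOp χ (MvPowerSeries.X α * g) =
      χ (Finsupp.single α 1) • (MvPowerSeries.X α * diagOp χ g) := by
  classical
  ext k
  rw [coeff_diagOp, map_smul, smul_eq_mul, MvPowerSeries.X_def, MvPowerSeries.coeff_monomial_mul,
    MvPowerSeries.coeff_monomial_mul]
  split_ifs with h
  · rw [coeff_diagOp]
    conv_lhs => rw [← add_tsub_cancel_of_le h, hχ]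
    rw [add_tsub_cancel_of_le h]; ring
  · simp

/-- A normal form with variables to the left of the diagonal operator; the two orders of composition
then differ only by a scalar. -/
theorem shiftOp_comp {χ ψ : (σ →₀ ℕ) → K} (hχ : ∀ k l, χ (k + l) = χ k * χ l)
    (hψ : ∀ k l, ψ (k + l) = ψ k * ψ l) (α β : σ) (g : MvPowerSeries σ K) :
    shiftOp χ α (shiftOp ψ β g) =
      (χ (Finsupp.single α 1) * ψ (Finsupp.single β 1) * χ (Finsupp.single β 1)) •
        (MvPowerSeries.X α * MvPowerSeries.X β * diagOp (χ * ψ) g) := by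
  have : diagOp (χ * ψ) g = diagOp χ (diagOp ψ g) := by
    ext k; simp [mul_assoc]
  rw [shiftOp_apply, shiftOp_apply, diagOp_X_mul hχ, diagOp_X_mul hψ, map_smul, diagOp_X_mul hχ,
    this, mul_smul_comm, mul_smul_comm, smul_smul, smul_smul, mul_assoc (MvPowerSeries.X α)]

theorem shiftOp_qcommute {χ ψ : (σ →₀ ℕ) → K} (hχ : ∀ k l, χ (k + l) = χ k * χ l)
    (hψ : ∀ k l, ψ (k + l) = ψ k * ψ l) (α β : σ) (q : K)
    (h : χ (Finsupp.single β 1) = q * ψ (Finsupp.single α 1)) :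
    shiftOp χ α * shiftOp ψ β = q • (shiftOp ψ β * shiftOp χ α) := by
  ext1 g
  rw [Module.End.mul_apply, LinearMap.smul_apply, Module.End.mul_apply, shiftOp_comp hχ hψ,
    shiftOp_comp hψ hχ, h, smul_smul, mul_comm ψ χ, mul_comm (MvPowerSeries.X β)]
  congr 1
  ring

/-- The factor with index `i` arises when a diagonal operator moves past `i + 1` copies of the
variable. -/
theorem shiftOp_pow {χ : (σ →₀ ℕ) → K} (hχ : ∀ k l, χ (k + l) = χ k * χ l) (α : σ) (n : ℕ)
    (g : MvPowerSeries σ K) : (shiftOp χ α ^ n) g =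
      (∏ i ∈ Finset.range n, χ (Finsupp.single α 1) ^ (i + 1)) •
        (MvPowerSeries.X α ^ n * diagOp (χ ^ n) g) := by
  induction n with
  | zero => simp; ext k; simp
  | succ n ih =>
    have hn : ∀ h : MvPowerSeries σ K, diagOp χ (MvPowerSeries.X α ^ n * h) =
        χ (Finsupp.single α 1) ^ n • (MvPowerSeries.X α ^ n * diagOp χ h) := by
      intro h
      clear ih
      induction n with
      | zero => simp
      | succ n ih =>
        rw [pow_succ', mul_assoc, diagOp_X_mul hχ, ih, mul_smul_comm, smul_smul, mul_assoc,
          ← pow_succ']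
    have : diagOp (χ ^ (n + 1)) g = diagOp χ (diagOp (χ ^ n) g) := by
      ext k; simp [pow_succ', mul_assoc]
    rw [pow_succ', Module.End.mul_apply, ih, map_smul, shiftOp_apply, diagOp_X_mul hχ, hn, this,
      mul_smul_comm, smul_smul, smul_smul, Finset.prod_range_succ, ← mul_assoc, ← pow_succ',
      mul_assoc, ← pow_succ']

end Rational

/-- The exponent is `m (m + 1) / 2`: a multiple of `m` for odd `m`, and congruent to `m / 2` modulo
`m` for even `m`, where `z ^ (m / 2) = -1`. -/
theorem prod_pow_succ_primitiveRoot {K : Type*} [CommRing K] [IsDomain K] {z : K} {m : ℕ}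
    (hm : 0 < m) (hz : IsPrimitiveRoot z m) :
    ∏ i ∈ Finset.range m, z ^ (i + 1) = (-1) ^ (m + 1) := by
  rw [Finset.prod_pow_eq_pow_sum, ← add_zero (∑ i ∈ Finset.range m, (i + 1)),
    ← Finset.sum_range_succ' (fun i => i), Finset.sum_range_id, Nat.add_sub_cancel]
  rcases Nat.even_or_odd' m with ⟨h, rfl | rfl⟩
  · have h0 : 0 < h := by omega
    have e : (2 * h + 1) * (2 * h) / 2 = 2 * h * h + h :=
      Nat.div_eq_of_eq_mul_left two_pos (by ring)
    have h1 : (z ^ h) ^ 2 = 1 := by rw [← pow_mul, mul_comm, hz.pow_eq_one]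
    have h2 : z ^ h = -1 :=
      (sq_eq_sq_iff_eq_or_eq_neg.1 (h1.trans (one_pow 2).symm)).resolve_left
      (hz.pow_ne_one_of_pos_of_lt h0.ne' (by omega))
    rw [e, pow_add, pow_mul, hz.pow_eq_one, one_pow, one_mul, h2, pow_succ, pow_mul]
    simp
  · have e : (2 * h + 1 + 1) * (2 * h + 1) / 2 = (2 * h + 1) * (h + 1) :=
      Nat.div_eq_of_eq_mul_left two_pos (by ring)
    rw [e, pow_mul, hz.pow_eq_one, one_pow, (show 2 * h + 1 + 1 = 2 * (h + 1) by ring), pow_mul]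
    simp

variable {σ : Type*} [Fintype σ]

/-! ### Characters of the exponent monoid with values in powers of a unit. -/

section Character

variable {B : Type*} [CommRing B]

/-- The character `k ↦ q ^ (c · k)`. -/
def unitChar (q : Bˣ) (c : σ → ℤ) (k : σ →₀ ℕ) : B := ((q ^ ∑ β, c β * (k β : ℤ) : Bˣ) : B)

theorem unitChar_add (q : Bˣ) (c : σ → ℤ) (k l : σ →₀ ℕ) :
    unitChar q c (k + l) = unitChar q c k * unitChar q c l := by
  rw [unitChar, unitChar, unitChar, ← Units.val_mul, ← zpow_add, ← Finset.sum_add_distrib]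
  congr 3
  funext β
  rw [Finsupp.add_apply]; push_cast; ring

theorem unitChar_single (q : Bˣ) (c : σ → ℤ) (α : σ) (n : ℕ) :
    unitChar q c (Finsupp.single α n) = ((q ^ (c α * n) : Bˣ) : B) := by
  classical
  rw [unitChar]
  congr 2
  simp [Finsupp.single_apply]

theorem unitChar_map {B' : Type*} [CommRing B'] (f : B →+* B') (q : Bˣ) (c : σ → ℤ)
    (k : σ →₀ ℕ) : f (unitChar q c k) = unitChar (Units.map f q) c k := by
  rw [unitChar, unitChar, ← map_zpow]; rfl

end Character

/-! ### The `q`-difference equation of `f_{𝒜,Q}(t,q)`. -/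

section Recurrence

/-- The sum telescopes along the order on the indices. -/
theorem sum_pow_mul_one_sub {ι B : Type*} [CommRing B] [LinearOrder ι] (q : B) (k : ι → ℕ)
    (s : Finset ι) :
    ∑ α ∈ s, q ^ (∑ β ∈ s with β < α, k β) * (1 - q ^ k α) = 1 - q ^ ∑ α ∈ s, k α := by
  induction s using Finset.induction_on_max with
  | empty => simp
  | insert a s ha ih =>
    have has : a ∉ s := fun h => (ha a h).false
    rw [Finset.sum_insert has, Finset.sum_insert has]
    have h1 : Finset.filter (· < a) (insert a s) = s := by
      ext x; simp only [Finset.mem_filter, Finset.mem_insert]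
      exact ⟨fun h => h.1.resolve_left h.2.ne, fun h => ⟨Or.inr h, ha x h⟩⟩
    have h2 : ∀ α ∈ s, Finset.filter (· < α) (insert a s) = Finset.filter (· < α) s := by
      intro α hα
      rw [Finset.filter_insert, if_neg (ha α hα).not_gt]
    rw [h1, Finset.sum_congr (s₁ := s) rfl fun α hα => congrArg (fun t => q ^ t.sum k * (1 - q ^ k α))
      (h2 α hα), ih, pow_add]
    ring

theorem qPoch_ne_zero (n : ℕ) : qPoch n ≠ 0 := by
  refine Finset.prod_ne_zero_iff.2 fun i _ h => ?_
  have := congrArg (Polynomial.eval 0) h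
  simp at this

theorem qMultinomial_zero : qMultinomial (0 : σ →₀ ℕ) = 1 := by
  have := qMultinomial_spec (0 : σ →₀ ℕ)
  simpa [qPoch] using this.symm

theorem one_sub_mul_qPoch (k : σ →₀ ℕ) (α : σ) :
    (1 - Polynomial.X ^ (k α + 1)) * qPoch (∑ β, k β) =
      (∏ β, qPoch ((k + Finsupp.single α 1 : σ →₀ ℕ) β)) * qMultinomial k := by
  classical
  rw [qMultinomial_spec, ← mul_assoc, ← Finset.mul_prod_erase _ _ (Finset.mem_univ α),
    ← Finset.mul_prod_erase _ (fun β => qPoch ((k + Finsupp.single α 1 : σ →₀ ℕ) β)) (Finset.mem_univ α)]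
  have : ∏ β ∈ Finset.univ.erase α, qPoch ((k + Finsupp.single α 1 : σ →₀ ℕ) β) =
      ∏ β ∈ Finset.univ.erase α, qPoch (k β) :=
    Finset.prod_congr rfl fun β hβ => by
      rw [Finsupp.add_apply, Finsupp.single_apply, if_neg (Finset.ne_of_mem_erase hβ).symm,
        add_zero]
  rw [this, Finsupp.add_apply, Finsupp.single_eq_same, qPoch_succ]
  ring

theorem sum_add_single (k : σ →₀ ℕ) (α : σ) :
    ∑ β, (k + Finsupp.single α 1 : σ →₀ ℕ) β = ∑ β, k β + 1 := by
  classical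
  simp [Finsupp.add_apply, Finset.sum_add_distrib, Finsupp.single_apply]

/-- The `q`-Pascal rule. Multiplied by the nonzero product of the `(q;q)_{k_α}`, it is the
telescoping identity times `(q;q)_{|k| - 1}`. -/
theorem qMultinomial_eq_sum [LinearOrder σ] {k : σ →₀ ℕ} (hk : k ≠ 0) :
    qMultinomial k = ∑ α, if Finsupp.single α 1 ≤ k then
      Polynomial.X ^ (∑ β with β < α, k β) * qMultinomial (k - Finsupp.single α 1) else 0 := by
  have hP : ∏ α, qPoch (k α) ≠ 0 := Finset.prod_ne_zero_iff.2 fun _ _ => qPoch_ne_zero _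
  refine mul_left_cancel₀ hP ?_
  obtain ⟨α₀, h₀⟩ := Finsupp.ne_iff.1 hk
  obtain ⟨n, hn⟩ : ∃ n, ∑ α, k α = n + 1 :=
    Nat.exists_eq_succ_of_ne_zero fun h =>
      h₀ (Finset.sum_eq_zero_iff.1 h α₀ (Finset.mem_univ _))
  rw [← qMultinomial_spec, hn, qPoch_succ, ← hn,
    ← sum_pow_mul_one_sub Polynomial.X k Finset.univ, Finset.mul_sum, Finset.mul_sum]
  refine Finset.sum_congr rfl fun α _ => ?_
  split_ifs with h
  · obtain ⟨l, rfl⟩ : ∃ l, k = l + Finsupp.single α 1 := ⟨_, (tsub_add_cancel_of_le h).symm⟩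
    have h1 := one_sub_mul_qPoch l α
    rw [sum_add_single, add_left_inj] at hn
    rw [hn] at h1
    rw [add_tsub_cancel_right, mul_left_comm (∏ α, _), ← h1, Finsupp.add_apply,
      Finsupp.single_eq_same]
    ring
  · have : k α = 0 := by
      by_contra h'
      exact h (Finsupp.single_le_iff.2 (Nat.one_le_iff_ne_zero.2 h'))
    rw [this]; simp

variable (Q : Matrix σ σ ℤ)

theorem diagDot_add_single (k : σ →₀ ℕ) (α : σ) :
    diagDot Q (k + Finsupp.single α 1 : σ →₀ ℕ) = Q α α + diagDot Q k := by
  classical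
  simp [diagDot, Finsupp.single_apply, mul_add, Finset.sum_add_distrib, add_comm]

/-- The summand `½ diag(Q) k` makes the increment linear in the new exponent `k + e_α`, so it acts
as a character applied after multiplication by `t_α`. -/
theorem qExponent_add_single (hQ : Q.IsSymm) (k : σ →₀ ℕ) (α : σ) :
    qExponent Q (k + Finsupp.single α 1 : σ →₀ ℕ) =
      ∑ β, Q α β * ((k + Finsupp.single α 1 : σ →₀ ℕ) β : ℕ) + qExponent Q k := by
  classical
  refine mul_left_cancel₀ (two_ne_zero (α := ℤ)) ?_
  rw [mul_add, two_mul_qExponent Q hQ, two_mul_qExponent Q hQ, diagDot_add_single]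
  have h1 : ∀ β γ, (((k + Finsupp.single α 1 : σ →₀ ℕ) β : ℕ) : ℤ) * Q β γ *
      ((k + Finsupp.single α 1 : σ →₀ ℕ) γ : ℕ) = k β * Q β γ * k γ +
      (if α = β then Q β γ * k γ else 0) + (if α = γ then k β * Q β γ else 0) +
      (if α = β then if α = γ then Q β γ else 0 else 0) := by
    intro β γ
    rw [Finsupp.add_apply, Finsupp.add_apply, Finsupp.single_apply, Finsupp.single_apply]
    split_ifs <;> push_cast <;> ring
  have h2 : ∀ β, Q α β * (((k + Finsupp.single α 1 : σ →₀ ℕ) β : ℕ) : ℤ) =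
      Q α β * k β + if α = β then Q α β else 0 := by
    intro β
    rw [Finsupp.add_apply, Finsupp.single_apply]
    split_ifs <;> push_cast <;> ring
  have h3 : ∑ β, (k β : ℤ) * Q β α = ∑ β, Q α β * k β :=
    Finset.sum_congr rfl fun β _ => by rw [hQ.apply, mul_comm]
  simp only [h1, h2, Finset.sum_add_distrib, Finset.sum_ite_irrel, Finset.sum_const_zero,
    Finset.sum_ite_eq, Finset.mem_univ, if_true, h3]
  ring

/-- The exponents `Q_αβ + [β < α]` in the `q`-difference equation of `f_{𝒜,Q}(t,q)`. -/
def twistExp [LinearOrder σ] (α β : σ) : ℤ := Q α β + if β < α then 1 else 0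

/-- The `q`-difference equation of `f_{𝒜,Q}(t,q)`, on coefficients. -/
theorem coeff_qSeries [LinearOrder σ] (hQ : Q.IsSymm) (k : σ →₀ ℕ) :
    MvPowerSeries.coeff k (qSeries Q) = (if k = 0 then 1 else 0) +
      ∑ α, LaurentPolynomial.C ((Q α α).negOnePow : ℤ) *
        LaurentPolynomial.T (∑ β, twistExp Q α β * (k β : ℤ)) *
        MvPowerSeries.coeff k (MvPowerSeries.X α * qSeries Q) := by
  simp only [MvPowerSeries.X_def, MvPowerSeries.coeff_monomial_mul, one_mul]
  split_ifs with hk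
  · subst hk
    rw [Finset.sum_eq_zero, add_zero]
    · change LaurentPolynomial.C _ * _ * _ = _
      rw [qMultinomial_zero]
      simp [diagDot, qExponent]
    · intro α _
      rw [if_neg, mul_zero]
      intro h
      simpa using Finsupp.single_le_iff.1 h
  · change LaurentPolynomial.C _ * _ * _ = _
    rw [qMultinomial_eq_sum hk, map_sum, Finset.mul_sum, zero_add]
    refine Finset.sum_congr rfl fun α _ => ?_
    split_ifs with h
    · obtain ⟨l, rfl⟩ : ∃ l, k = l + Finsupp.single α 1 := ⟨_, (tsub_add_cancel_of_le h).symm⟩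
      rw [add_tsub_cancel_right]
      change _ = _ * (LaurentPolynomial.C _ * _ * _)
      have e : ∑ β, twistExp Q α β * (((l + Finsupp.single α 1 : σ →₀ ℕ) β : ℕ) : ℤ) =
          ∑ β, Q α β * (((l + Finsupp.single α 1 : σ →₀ ℕ) β : ℕ) : ℤ) +
            (∑ β with β < α, (l + Finsupp.single α 1 : σ →₀ ℕ) β : ℕ) := by
        simp only [twistExp, add_mul, ite_mul, one_mul, zero_mul, Finset.sum_add_distrib,
          ← Finset.sum_filter]
        push_cast
        rfl
      rw [diagDot_add_single, qExponent_add_single Q hQ, Int.negOnePow_add, map_mul, e,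
        Polynomial.toLaurent_X_pow, Units.val_mul, map_mul, LaurentPolynomial.T_add,
        LaurentPolynomial.T_add]
      ring
    · simp

end Recurrence

/-! ### Rationality of the Taylor coefficients at a root of unity. -/

section QDifference

variable {σ : Type*} [Fintype σ] (Q : Matrix σ σ ℤ)

theorem cast_negOnePow {K : Type*} [CommRing K] (n : ℤ) :
    (((n.negOnePow : ℤ)) : K) = (((-1 : Kˣ) ^ n : Kˣ) : K) := by
  have h : (Units.map (Int.castRingHom K : ℤ →* K) : ℤˣ →* Kˣ) (-1) = -1 := by ext; simp
  rw [← h, ← map_zpow]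
  rfl

/-- The polynomial `1 - ∑_α (-1)^{Q_αα} s_α^m`. -/
def denomPow (K : Type*) [CommRing K] (m : ℕ) : MvPolynomial σ K :=
  1 - ∑ α, MvPolynomial.C (((Q α α).negOnePow : ℤ) : K) * MvPolynomial.X α ^ m

theorem coe_denomPow (K : Type*) [CommRing K] (m : ℕ) :
    (denomPow Q K m : MvPowerSeries σ K) =
      1 - ∑ α, (((Q α α).negOnePow : ℤ) : K) • MvPowerSeries.X α ^ m := by
  rw [← MvPolynomial.coeToMvPowerSeries.ringHom_apply, denomPow, map_sub, map_one, map_sum]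
  refine congrArg _ (Finset.sum_congr rfl fun α _ => ?_)
  rw [map_mul, map_pow, MvPowerSeries.smul_eq_C_mul, MvPolynomial.coeToMvPowerSeries.ringHom_apply,
    MvPolynomial.coeToMvPowerSeries.ringHom_apply, MvPolynomial.coe_C, MvPolynomial.coe_X]

variable {K : Type*} [CommRing K]

theorem unitChar_pow_eq_one {u : Kˣ} {m : ℕ} (hu : u ^ m = 1) (c : σ → ℤ) :
    unitChar u c ^ m = 1 := by
  funext k
  rw [Pi.pow_apply, unitChar, ← Units.val_pow_eq_pow_val, ← zpow_natCast, zpow_comm,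
    zpow_natCast, hu, one_zpow]
  rfl

theorem unitChar_coeff_zero (q : (PowerSeries K)ˣ) (c : σ → ℤ) :
    (fun k => PowerSeries.coeff 0 (unitChar q c k)) =
      unitChar (Units.map (PowerSeries.constantCoeff (R := K) : PowerSeries K →* K) q) c := by
  funext k
  rw [PowerSeries.coeff_zero_eq_constantCoeff_apply, unitChar_map]

theorem X_mul_mem_ratSeries {σ K : Type*} [CommRing K] {d : MvPolynomial σ K} (α : σ) {g : MvPowerSeries σ K}
    (hg : g ∈ ratSeries d) : MvPowerSeries.X α * g ∈ ratSeries d := by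
  rw [← MvPolynomial.coe_X]
  exact mul_mem_ratSeries _ hg

variable [LinearOrder σ]

/-- The operator `g ↦ ∑_α (-1)^{Q_αα} s_α · g(u^{c_α} s)`, up to scalars, through which the
`q`-difference equation at `q = u` is expressed. -/
def stepOp (u : Kˣ) : Module.End K (MvPowerSeries σ K) :=
  ∑ α, (((Q α α).negOnePow : ℤ) : K) • shiftOp (unitChar u (twistExp Q α)) α

theorem stepOp_apply (u : Kˣ) (g : MvPowerSeries σ K) : stepOp Q u g =
    ∑ α, (((Q α α).negOnePow : ℤ) : K) •
      diagOp (unitChar u (twistExp Q α)) (MvPowerSeries.X α * g) := by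
  simp [stepOp, shiftOp_apply]

/-- The `m`-th power of the character is trivial. The scalars give the sign `(-1)^{Q_αα m}`, the
reordering gives `(-1)^{Q_αα (m+1)}`, and together they give `(-1)^{Q_αα}`. -/
theorem shiftOp_unitChar_pow [IsDomain K] {u : Kˣ} {m : ℕ} (hm : 0 < m)
    (hu : IsPrimitiveRoot (u : K) m) (α : σ) (g : MvPowerSeries σ K) :
    (((((Q α α).negOnePow : ℤ) : K) • shiftOp (unitChar u (twistExp Q α)) α) ^ m) g =
      (((Q α α).negOnePow : ℤ) : K) • (MvPowerSeries.X α ^ m * g) := by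
  have hum : u ^ m = 1 := Units.ext (by simpa using hu.pow_eq_one)
  have hone : diagOp (1 : (σ →₀ ℕ) → K) g = g := by ext k; simp
  have hprod : ∏ i ∈ Finset.range m, u ^ (i + 1) = (-1) ^ (m + 1) := by
    refine Units.ext ?_
    have := prod_pow_succ_primitiveRoot hm hu
    push_cast
    simpa using this
  rw [smul_pow, LinearMap.smul_apply, shiftOp_pow (unitChar_add u _), smul_smul,
    unitChar_pow_eq_one hum, hone, cast_negOnePow]
  congr 1
  have h1 : ∏ i ∈ Finset.range m,
      unitChar u (twistExp Q α) (Finsupp.single α 1) ^ (i + 1) =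
        (((∏ i ∈ Finset.range m, u ^ (i + 1)) ^ Q α α : Kˣ) : K) := by
    rw [← Finset.prod_zpow, Units.coe_prod]
    refine Finset.prod_congr rfl fun i _ => ?_
    rw [unitChar_single, ← Units.val_pow_eq_pow_val, twistExp, if_neg (lt_irrefl α), add_zero,
      Nat.cast_one, mul_one, ← zpow_natCast, zpow_comm, zpow_natCast]
  rw [h1, hprod, ← Units.val_pow_eq_pow_val, ← Units.val_mul]
  congr 1
  rw [← zpow_natCast, zpow_comm, ← mul_zpow, zpow_natCast, ← pow_add,
    (show m + (m + 1) = 2 * m + 1 by ring), pow_succ, pow_mul]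
  simp

/-- At a primitive `m`-th root of unity, the `m`-th power of the step operator is a
multiplication operator. -/
theorem stepOp_pow [IsDomain K] {u : Kˣ} {m : ℕ} (hm : 0 < m)
    (hu : IsPrimitiveRoot (u : K) m) (hQ : Q.IsSymm) (g : MvPowerSeries σ K) :
    g - (stepOp Q u ^ m) g = (denomPow Q K m : MvPowerSeries σ K) * g := by
  rw [stepOp, sum_pow_of_qcommute_primitiveRoot hm hu, LinearMap.sum_apply,
    Finset.sum_congr rfl fun α _ => shiftOp_unitChar_pow Q hm hu α g, coe_denomPow, sub_mul,
    one_mul, Finset.sum_mul]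
  · simp only [smul_mul_assoc]
  -- By symmetry of `Q` the two reordering exponents differ only by `[β < α] = 1`, which is the
  -- required factor `u`.
  · intro α β hβ
    rw [smul_mul_smul_comm, smul_mul_smul_comm,
      shiftOp_qcommute (unitChar_add u _) (unitChar_add u _) α β (u : K), smul_comm, mul_comm]
    rw [unitChar_single, unitChar_single, ← Units.val_mul, twistExp, twistExp, if_pos hβ,
      if_neg hβ.not_gt, hQ.apply, Nat.cast_one, mul_one, mul_one, add_zero, zpow_add, zpow_one,
      mul_comm]

/-- Only `m`-th powers of variables occur in the denominator, so the character is trivial on its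
support. This supplies the hypothesis on `d` in `diagOp_mem_ratSeries`. -/
theorem diagOp_denomPow {u : Kˣ} {m : ℕ} (hu : u ^ m = 1) (c : σ → ℤ) :
    diagOp (unitChar u c) (denomPow Q K m : MvPowerSeries σ K) = denomPow Q K m := by
  have hX : ∀ α, diagOp (unitChar u c) (MvPowerSeries.X α ^ m : MvPowerSeries σ K) =
      MvPowerSeries.X α ^ m := by
    intro α
    ext k
    rw [coeff_diagOp, MvPowerSeries.coeff_X_pow]
    split_ifs with h
    · rw [h, unitChar_single, mul_comm (c α), zpow_mul, zpow_natCast, hu]; simp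
    · simp
  have h1 : diagOp (unitChar u c) (1 : MvPowerSeries σ K) = 1 := by
    ext k
    rw [coeff_diagOp, MvPowerSeries.coeff_one]
    split_ifs with h
    · subst h; simp [unitChar]
    · simp
  rw [coe_denomPow, map_sub, h1, map_sum]
  simp only [map_smul, hX]

variable {q : (PowerSeries K)ˣ} {m : ℕ}

theorem diagOp_coeff_mem
    (hq : Units.map (PowerSeries.constantCoeff (R := K) : PowerSeries K →* K) q ^ m = 1)
    (c : σ → ℤ) (n : ℕ) {g : MvPowerSeries σ K} (hg : g ∈ ratSeries (denomPow Q K m)) :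
    diagOp (fun k => PowerSeries.coeff n (unitChar q c k)) g ∈ ratSeries (denomPow Q K m) := by
  refine diagOp_mem_ratSeries (unitChar_add q c) ?_ n hg
  rw [unitChar_coeff_zero]
  exact diagOp_denomPow Q hq c

/-- Applying `1 + L + ⋯ + L^{m-1}`, which preserves rationality, to `(1 - L) g` produces the
denominator times `g`. -/
theorem mem_ratSeries_of_sub_stepOp_mem [IsDomain K] (hm : 0 < m) (hQ : Q.IsSymm)
    (hq : IsPrimitiveRoot (PowerSeries.constantCoeff (q : PowerSeries K)) m)
    {g : MvPowerSeries σ K}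
    (hg : g - stepOp Q (Units.map (PowerSeries.constantCoeff (R := K) : PowerSeries K →* K) q) g ∈
      ratSeries (denomPow Q K m)) : g ∈ ratSeries (denomPow Q K m) := by
  set u := Units.map (PowerSeries.constantCoeff (R := K) : PowerSeries K →* K) q with hu
  have hum : u ^ m = 1 :=
    Units.ext (by rw [Units.val_pow_eq_pow_val]; exact hq.pow_eq_one)
  have hstep : ∀ h ∈ ratSeries (denomPow Q K m), stepOp Q u h ∈ ratSeries (denomPow Q K m) := by
    intro h hh
    rw [stepOp_apply]
    refine Submodule.sum_mem _ fun α _ => Submodule.smul_mem _ _ ?_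
    rw [hu, ← unitChar_coeff_zero]
    exact diagOp_coeff_mem Q hum _ 0 (X_mul_mem_ratSeries α hh)
  have hpow : ∀ i, ∀ h ∈ ratSeries (denomPow Q K m),
      (stepOp Q u ^ i) h ∈ ratSeries (denomPow Q K m) := by
    intro i
    induction i with
    | zero => exact fun h hh => hh
    | succ i ih =>
      intro h hh
      rw [pow_succ, Module.End.mul_apply]
      exact ih _ (hstep h hh)
  refine mem_ratSeries_of_mul_mem ?_
  rw [← stepOp_pow Q hm (u := u) hq hQ]
  have h1 : g - (stepOp Q u ^ m) g =
      (∑ i ∈ Finset.range m, stepOp Q u ^ i) (g - stepOp Q u g) := by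
    have := congrArg (fun T => T g) (geom_sum_mul_neg (stepOp Q u) m)
    exact this.symm
  rw [h1, LinearMap.sum_apply]
  exact Submodule.sum_mem _ fun i _ => hpow i _ hg

/-- Solutions of the `q`-difference equation have rational coefficients. -/
theorem mem_ratSeries_of_recurrence [IsDomain K] (hm : 0 < m) (hQ : Q.IsSymm)
    (hq : IsPrimitiveRoot (PowerSeries.constantCoeff (q : PowerSeries K)) m)
    (f : ℕ → MvPowerSeries σ K)
    (hf : ∀ n, f n = (if n = 0 then 1 else 0) +
      ∑ α, (((Q α α).negOnePow : ℤ) : K) • ∑ ij ∈ Finset.HasAntidiagonal.antidiagonal n,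
        diagOp (fun k => PowerSeries.coeff ij.1 (unitChar q (twistExp Q α) k))
          (MvPowerSeries.X α * f ij.2)) (n : ℕ) :
    f n ∈ ratSeries (denomPow Q K m) := by
  induction n using Nat.strong_induction_on with
  | _ n ih =>
    refine mem_ratSeries_of_sub_stepOp_mem Q hm hQ hq ?_
    rw [stepOp_apply]
    nth_rw 1 [hf n]
    rw [add_sub_assoc, ← Finset.sum_sub_distrib]
    refine Submodule.add_mem _ ?_ (Submodule.sum_mem _ fun α _ => ?_)
    · split_ifs
      · simpa using coe_mem_ratSeries (d := denomPow Q K m) (1 : MvPolynomial σ K)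
      · exact zero_mem _
    -- The term `(0, n)` is the contribution of the step operator and cancels; the remaining terms
    -- involve only `f j` with `j < n`.
    · rw [← smul_sub, ← Finset.add_sum_erase _ _
        (show (0, n) ∈ Finset.HasAntidiagonal.antidiagonal n by simp), unitChar_coeff_zero,
        add_sub_cancel_left]
      refine Submodule.smul_mem _ _ (Submodule.sum_mem _ fun ij hij => ?_)
      rw [Finset.mem_erase, Finset.HasAntidiagonal.mem_antidiagonal] at hij
      obtain ⟨h2, h3⟩ := hij
      have : ij.1 ≠ 0 := fun h => h2 (by ext <;> simp <;> omega)
      refine diagOp_coeff_mem Q ?_ _ _ (X_mul_mem_ratSeries α (ih _ (by omega)))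
      exact Units.ext (by simpa using hq.pow_eq_one)

/-- The coefficient of `(q - ζ_m)^n` in the expansion at `q = ζ_m` of `f ∈ ℤ[q, q⁻¹]⟦t⟧`. -/
def taylorCoeff {σ : Type*} (Z : RootSystem) (m : ℕ+) (f : MvPowerSeries σ ℤ[T;T⁻¹]) (n : ℕ) :
    MvPowerSeries σ (Cyc Z m) :=
  fun k => PowerSeries.coeff n (laurentAt Z m (MvPowerSeries.coeff k f))

theorem coeff_taylorCoeff {σ : Type*} (Z : RootSystem) (m : ℕ+) (f : MvPowerSeries σ ℤ[T;T⁻¹])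
    (n : ℕ) (k : σ →₀ ℕ) : MvPowerSeries.coeff k (taylorCoeff Z m f n) =
      PowerSeries.coeff n (laurentAt Z m (MvPowerSeries.coeff k f)) := rfl

theorem zeta_primitive (Z : RootSystem) (m : ℕ+) : IsPrimitiveRoot (zeta Z m) (m : ℕ) :=
  IsPrimitiveRoot.of_map_of_injective (f := (Cyc Z m).val) (Z.primitive m) Subtype.val_injective

/-- Expanding `coeff_qSeries` in powers of `q - ζ_m` turns the products of Laurent polynomials into
the convolutions of `mem_ratSeries_of_recurrence`. -/
theorem taylorCoeff_mem_ratSeries (hQ : Q.IsSymm) (Z : RootSystem) (m : ℕ+) (n : ℕ) :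
    taylorCoeff Z m (qSeries Q) n ∈ ratSeries (denomPow Q (Cyc Z m) m) := by
  refine mem_ratSeries_of_recurrence Q m.pos hQ (q := (isUnit_q Z m).unit) ?_ _ ?_ n
  · simpa using zeta_primitive Z m
  · intro n
    ext1 k
    rw [coeff_taylorCoeff, coeff_qSeries Q hQ, map_add, map_add, map_sum, map_sum, map_add,
      map_sum]
    congr 1
    · rw [apply_ite (laurentAt Z m), map_one, map_zero, apply_ite (PowerSeries.coeff n),
        PowerSeries.coeff_one, map_zero, apply_ite (MvPowerSeries.coeff k),
        MvPowerSeries.coeff_one, map_zero]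
      split_ifs <;> rfl
    · refine Finset.sum_congr rfl fun α _ => ?_
      rw [map_mul (laurentAt Z m), map_mul (laurentAt Z m), laurentAt, LaurentPolynomial.eval₂_C, LaurentPolynomial.eval₂_T,
        ← laurentAt, map_smul, map_sum, eq_intCast, mul_assoc, smul_eq_mul,
        ← map_intCast (PowerSeries.C (R := Cyc Z m)), PowerSeries.coeff_C_mul,
        PowerSeries.coeff_mul]
      congr 1
      refine Finset.sum_congr rfl fun ij _ => ?_
      rw [coeff_diagOp]
      congr 1
      simp only [MvPowerSeries.X_def, MvPowerSeries.coeff_monomial_mul]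
      split_ifs
      · rw [one_mul, one_mul]; rfl
      · simp

end QDifference

/-! ### Expansion at `t = 0`: its image and its injectivity. -/

section Expansion

variable {σ : Type*} [Fintype σ] (Q : Matrix σ σ ℤ) (Z : RootSystem) (m : ℕ+)

/-- The inclusion `ℤ[ζ_m][t^{1/m}] → R_m`. -/
def ofRootPoly (R : Type*) [CommRing R] [Algebra (MvPolynomial σ ℤ) R] :
    RootPoly σ Z m →+* Ext (σ := σ) R Z m :=
  (Algebra.TensorProduct.includeRight (R := MvPolynomial σ ℤ) (A := R) (B := RootPoly σ Z m) :
    RootPoly σ Z m →+* Ext (σ := σ) R Z m)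

theorem ofRootPoly_algebraMap {σ : Type*} (Z : RootSystem) (m : ℕ+) (R : Type*) [CommRing R] [Algebra (MvPolynomial σ ℤ) R]
    (a : MvPolynomial σ ℤ) : ofRootPoly Z m R (algebraMap _ _ a) =
      (algebraMap (MvPolynomial σ ℤ) R a) ⊗ₜ (1 : RootPoly σ Z m) :=
  (Algebra.TensorProduct.includeRight (R := MvPolynomial σ ℤ) (A := R)
    (B := RootPoly σ Z m)).commutes a

theorem expand_ofRootPoly (P : RootPoly σ Z m) :
    expand Q Z m (ofRootPoly Z m (RatRing Q) P) = RootPoly.toSeries σ Z m P := by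
  refine (tensorLift_tmul _ _ _ 1 P).trans ?_
  rw [map_one, one_mul]

theorem algebraMap_denom : algebraMap (MvPolynomial σ ℤ) (RootPoly σ Z m) (denom Q) =
    (denomPow Q (Cyc Z m) m : MvPolynomial σ (Cyc Z m)) := by
  rw [denom, map_sub, map_one, map_sum]
  change (1 : MvPolynomial σ (Cyc Z m)) - _ = _
  rw [denomPow]
  congr 1
  refine Finset.sum_congr rfl fun α _ => ?_
  rw [map_mul, RootPoly.algebraMap_X, eq_intCast MvPolynomial.C, map_intCast]
  exact congrArg (· * _) (map_intCast (MvPolynomial.C : Cyc Z m →+* MvPolynomial σ (Cyc Z m)) _).symm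

theorem isUnit_ofRootPoly_denom : IsUnit (ofRootPoly Z m (RatRing Q)
    (algebraMap (MvPolynomial σ ℤ) (RootPoly σ Z m) (denom Q))) := by
  rw [ofRootPoly_algebraMap]
  exact (IsLocalization.Away.algebraMap_isUnit (S := RatRing Q) (denom Q)).map
    (Algebra.TensorProduct.includeLeftRingHom
      (R := MvPolynomial σ ℤ) (A := RatRing Q) (B := RootPoly σ Z m))

/-- Every element of `R_m` becomes a polynomial after multiplication by a power of the
denominator. -/
theorem exists_mul_denom_pow_eq (x : Ext (σ := σ) (RatRing Q) Z m) :
    ∃ (M : ℕ) (P : RootPoly σ Z m), x * ofRootPoly Z m (RatRing Q)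
      (algebraMap (MvPolynomial σ ℤ) (RootPoly σ Z m) (denom Q)) ^ M =
        ofRootPoly Z m (RatRing Q) P := by
  induction x using TensorProduct.induction_on with
  | zero => exact ⟨0, 0, by simp⟩
  | add x y hx hy =>
    obtain ⟨M, P, hP⟩ := hx
    obtain ⟨N, S, hS⟩ := hy
    refine ⟨M + N, P * algebraMap _ _ (denom Q) ^ N + S * algebraMap _ _ (denom Q) ^ M, ?_⟩
    rw [map_add, map_mul, map_mul, map_pow, map_pow, ← hP, ← hS]
    ring
  | tmul b c =>
    obtain ⟨M, a, ha⟩ := IsLocalization.Away.surj (denom Q) b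
    refine ⟨M, algebraMap _ _ a * c, ?_⟩
    rw [map_mul, ofRootPoly_algebraMap, ofRootPoly_algebraMap,
      Algebra.TensorProduct.tmul_pow, Algebra.TensorProduct.tmul_mul_tmul, ha, one_pow, mul_one]
    change _ = _ * ((1 : RatRing Q) ⊗ₜ[MvPolynomial σ ℤ] c)
    rw [Algebra.TensorProduct.tmul_mul_tmul, one_mul, mul_one]

/-- The denominator is a unit both in `R_m` and in the power series ring, so the quotient can be
formed in `R_m` and compared after clearing it. -/
theorem exists_expand_eq {g : MvPowerSeries σ (Cyc Z m)}
    (hg : g ∈ ratSeries (denomPow Q (Cyc Z m) m)) : ∃ x, expand Q Z m x = g := by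
  obtain ⟨M, p, hp⟩ := hg
  obtain ⟨u, hu⟩ := isUnit_ofRootPoly_denom Q Z m
  refine ⟨ofRootPoly Z m (RatRing Q) p * ((u⁻¹ ^ M : Units _) : Ext (σ := σ) (RatRing Q) Z m), ?_⟩
  have hD : IsUnit ((denomPow Q (Cyc Z m) m : MvPowerSeries σ (Cyc Z m))) := by
    have := isUnit_denom Q Z m
    rwa [RingHom.comp_apply, algebraMap_denom] at this
  have huD : expand Q Z m u = (denomPow Q (Cyc Z m) m : MvPowerSeries σ (Cyc Z m)) := by
    rw [hu, expand_ofRootPoly, algebraMap_denom]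
    rfl
  refine (hD.pow M).mul_left_cancel ?_
  rw [hp, ← huD, ← map_pow, ← map_mul, mul_left_comm, ← Units.val_pow_eq_pow_val, ← Units.val_mul,
    ← mul_pow, mul_inv_cancel, one_pow, Units.val_one, mul_one]
  exact expand_ofRootPoly Q Z m p

/-- Divisibility by a constant can be tested on the expansion at `t = 0`. -/
theorem dvd_of_forall_dvd_coeff_expand (c : Cyc Z m) (x : Ext (σ := σ) (RatRing Q) Z m)
    (h : ∀ k, c ∣ MvPowerSeries.coeff k (expand Q Z m x)) :
    ofRootPoly Z m (RatRing Q) (RootPoly.const Z m c) ∣ x := by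
  classical
  obtain ⟨M, P, hP⟩ := exists_mul_denom_pow_eq Q Z m x
  have hP' : ∀ k, c ∣ MvPolynomial.coeff k (P : MvPolynomial σ (Cyc Z m)) := by
    intro k
    have h1 := congrArg (expand Q Z m) hP
    rw [map_mul, expand_ofRootPoly] at h1
    have h2 := congrArg (MvPowerSeries.coeff k) h1
    rw [MvPowerSeries.coeff_mul] at h2
    refine (Finset.dvd_sum fun ij _ => ?_).trans (dvd_of_eq h2)
    exact (h _).mul_right _
  obtain ⟨P', hP''⟩ := (MvPolynomial.C_dvd_iff_dvd_coeff c P).2 hP'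
  have hx : ofRootPoly Z m (RatRing Q) (RootPoly.const Z m c) ∣
      x * ofRootPoly Z m (RatRing Q)
        (algebraMap (MvPolynomial σ ℤ) (RootPoly σ Z m) (denom Q)) ^ M := by
    rw [hP]
    refine map_dvd _ ⟨P', hP''⟩
  -- Divisibility holds for the polynomial numerator, where it is coefficientwise, and the
  -- denominator is a unit.
  exact ((isUnit_ofRootPoly_denom Q Z m).pow M).dvd_mul_right.1 hx

theorem expand_injective : Function.Injective (expand Q Z m) := by
  refine (injective_iff_map_eq_zero _).2 fun x hx => ?_
  -- Divisibility by the constant `0` means being zero.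
  have := dvd_of_forall_dvd_coeff_expand Q Z m 0 x fun k => by rw [hx, map_zero]
  rwa [map_zero, map_zero, zero_dvd_iff] at this

variable {Z m} in
-- Since `R` is a localization of `ℤ[t]`, constants and variables determine a homomorphism out of
-- `R_m`. This identifies the inclusion and the Frobenius after expansion.
theorem ext_ringHom_ext {S : Type*} [CommRing S] {f g : Ext (σ := σ) (RatRing Q) Z m →+* S}
    (hc : ∀ z, f (1 ⊗ₜ RootPoly.const Z m z) = g (1 ⊗ₜ RootPoly.const Z m z))
    (hv : ∀ α, f (1 ⊗ₜ RootPoly.var Z m α) = g (1 ⊗ₜ RootPoly.var Z m α)) : f = g := by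
  have hR : f.comp (ofRootPoly Z m (RatRing Q)) = g.comp (ofRootPoly Z m (RatRing Q)) :=
    RootPoly.hom_ext hc hv
  refine tensor_hom_ext (fun r => ?_) (fun c => RingHom.congr_fun hR c)
  have hL : f.comp (Algebra.TensorProduct.includeLeftRingHom
        (R := MvPolynomial σ ℤ) (A := RatRing Q) (B := RootPoly σ Z m)) =
      g.comp (Algebra.TensorProduct.includeLeftRingHom
        (R := MvPolynomial σ ℤ) (A := RatRing Q) (B := RootPoly σ Z m)) := by
    refine IsLocalization.ringHom_ext (Submonoid.powers (denom Q)) (RingHom.ext fun a => ?_)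
    have := RingHom.congr_fun hR (algebraMap (MvPolynomial σ ℤ) (RootPoly σ Z m) a)
    rwa [RingHom.comp_apply, RingHom.comp_apply, ofRootPoly_algebraMap] at this
  exact RingHom.congr_fun hL r

end Expansion

/-! ### Expansion modulo `p^N`, and the inclusion and Frobenius as `s ↦ s^p`. -/

section Reduction

variable {σ : Type*} [Fintype σ] (Q : Matrix σ σ ℤ) (Z : RootSystem) (p m : ℕ+) (N : ℕ)

/-- The ring `ℤ[ζ_m] / p^N`. -/
abbrev CycMod : Type := Cyc Z m ⧸ Ideal.span {((p : ℕ) : Cyc Z m) ^ N}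

/-- Reduction modulo `p^N` on `ℤ[ζ_m]`. -/
abbrev cycMk : Cyc Z m →+* CycMod Z p m N := Ideal.Quotient.mk _

/-- The expansion at `t = 0` modulo `p^N`. -/
def expandMod : Ext (σ := σ) (RatRing Q) Z m ⧸ pIdeal (σ := σ) (RatRing Q) Z p m ^ N →+*
    MvPowerSeries σ (CycMod Z p m N) :=
  Ideal.Quotient.lift _ ((MvPowerSeries.map (cycMk Z p m N)).comp (expand Q Z m)) (by
    intro x hx
    rw [Ideal.span_singleton_pow, Ideal.mem_span_singleton] at hx
    obtain ⟨y, rfl⟩ := hx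
    have h : ((p : ℕ) : CycMod Z p m N) ^ N = 0 := by
      rw [← map_natCast (cycMk Z p m N), ← map_pow, Ideal.Quotient.eq_zero_iff_mem]
      exact Ideal.mem_span_singleton_self _
    rw [map_mul, map_pow, map_natCast, ← map_natCast (MvPowerSeries.C (σ := σ)), ← map_pow, h,
      map_zero, zero_mul])

theorem expandMod_mk (x : Ext (σ := σ) (RatRing Q) Z m) :
    expandMod Q Z p m N (Ideal.Quotient.mk _ x) =
      MvPowerSeries.map (cycMk Z p m N) (expand Q Z m x) := rfl

/-- An element whose expansion is coefficientwise divisible by `p^N` is itself divisible by `p^N`;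
hence the gluing conditions can be checked on coefficients. -/
theorem expandMod_injective : Function.Injective (expandMod Q Z p m N) := by
  refine (injective_iff_map_eq_zero _).2 fun x hx => ?_
  obtain ⟨x, rfl⟩ := Ideal.Quotient.mk_surjective x
  rw [expandMod_mk] at hx
  rw [Ideal.Quotient.eq_zero_iff_mem, Ideal.span_singleton_pow, Ideal.mem_span_singleton]
  have := dvd_of_forall_dvd_coeff_expand Q Z m (((p : ℕ) : Cyc Z m) ^ N) x fun k => by
    have hk := congrArg (MvPowerSeries.coeff k) hx
    rwa [MvPowerSeries.coeff_map, map_zero, Ideal.Quotient.eq_zero_iff_mem,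
      Ideal.mem_span_singleton] at hk
  rwa [map_pow, map_pow, map_natCast, map_natCast] at this

theorem expand_const (z : Cyc Z m) : expand Q Z m (1 ⊗ₜ RootPoly.const Z m z) =
    MvPowerSeries.C z :=
  (expand_ofRootPoly Q Z m _).trans (MvPolynomial.coe_C z)

theorem expand_var (α : σ) : expand Q Z m (1 ⊗ₜ RootPoly.var Z m α) = MvPowerSeries.X α :=
  (expand_ofRootPoly Q Z m _).trans (MvPolynomial.coe_X α)

theorem expandMod_incl (x : Ext (σ := σ) (RatRing Q) Z m) :
    expandMod Q Z p (p * m) N (Ideal.Quotient.mk _ (Ext.incl (RatRing Q) Z p m x)) =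
      MvPowerSeries.expand p p.ne_zero (MvPowerSeries.map
        ((cycMk Z p (p * m) N).comp (cycIncl Z p m).toRingHom) (expand Q Z m x)) := by
  suffices h : ((expandMod Q Z p (p * m) N).comp (Ideal.Quotient.mk _)).comp
      (Ext.incl (RatRing Q) Z p m) =
      ((MvPowerSeries.expand p p.ne_zero).toRingHom.comp (MvPowerSeries.map
        ((cycMk Z p (p * m) N).comp (cycIncl Z p m).toRingHom))).comp (expand Q Z m) from
    RingHom.congr_fun h x
  have hincl : ∀ c : RootPoly σ Z m, Ext.incl (RatRing Q) Z p m (1 ⊗ₜ c) =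
      1 ⊗ₜ RootPoly.incl Z p m c := fun c => rfl
  refine ext_ringHom_ext Q (fun z => ?_) (fun α => ?_)
  · rw [RingHom.comp_apply, hincl, RootPoly.incl, RootPoly.lift_const, RingHom.comp_apply,
      expandMod_mk, RingHom.comp_apply (RootPoly.const _ _), expand_const, RingHom.comp_apply,
      expand_const, RingHom.comp_apply, MvPowerSeries.map_C, MvPowerSeries.map_C]
    exact (MvPowerSeries.expand_C _ _ _).symm
  · rw [RingHom.comp_apply, hincl, RootPoly.incl, RootPoly.lift_var, RingHom.comp_apply,
      expandMod_mk, ← one_pow (M := RatRing Q) (p : ℕ), ← Algebra.TensorProduct.tmul_pow,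
      map_pow, expand_var, RingHom.comp_apply, one_pow,
      expand_var, RingHom.comp_apply, map_pow, MvPowerSeries.map_X, MvPowerSeries.map_X]
    exact (MvPowerSeries.expand_X _ _ _).symm

theorem expandMod_frobenius (hp : Nat.Prime p) (x : Ext (σ := σ) (RatRing Q) Z m) :
    expandMod Q Z p m N (AdicCompletion.evalₐ (pIdeal (σ := σ) (RatRing Q) Z p m) N
      (frobenius (RatRing Q) Z hp m x)) =
      MvPowerSeries.expand p p.ne_zero
        (MvPowerSeries.map (cycMk Z p m N) (expand Q Z m x)) := by
  suffices h : ((expandMod Q Z p m N).comp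
      (AdicCompletion.evalₐ (pIdeal (σ := σ) (RatRing Q) Z p m) N : _ →+* _)).comp
      (frobenius (RatRing Q) Z hp m) =
      ((MvPowerSeries.expand p p.ne_zero).toRingHom.comp (MvPowerSeries.map
        (cycMk Z p m N))).comp (expand Q Z m) from
    RingHom.congr_fun h x
  have hφ := isFrobenius_frobenius (σ := σ) (RatRing Q) Z hp m
  have heval : ∀ y : Ext (σ := σ) (RatRing Q) Z m,
      AdicCompletion.evalₐ (pIdeal (σ := σ) (RatRing Q) Z p m) N (algebraMap _ _ y) =
        Ideal.Quotient.mk _ y := fun y =>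
    (AdicCompletion.evalₐ (pIdeal (σ := σ) (RatRing Q) Z p m) N).commutes y
  refine ext_ringHom_ext Q (fun z => ?_) (fun α => ?_)
  · rw [RingHom.comp_apply, hφ.map_const, RingHom.comp_apply, RingHom.coe_coe, heval,
      expandMod_mk, expand_const, RingHom.comp_apply, expand_const, RingHom.comp_apply,
      MvPowerSeries.map_C]
    exact (MvPowerSeries.expand_C _ _ _).symm
  · rw [RingHom.comp_apply, hφ.map_var, map_pow, RingHom.comp_apply, RingHom.coe_coe, heval,
      expandMod_mk, expand_var, RingHom.comp_apply, expand_var, RingHom.comp_apply,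
      MvPowerSeries.map_X]
    exact (MvPowerSeries.expand_X _ _ _).symm

end Reduction

/-! ### Re-expansion, the gluing conditions, and existence and uniqueness. -/

section Gluing

theorem hasSubst_X_add_C {B : Type*} [CommRing B] {c : B} (hc : IsNilpotent c) :
    PowerSeries.HasSubst (PowerSeries.X + PowerSeries.C c : PowerSeries B) := by
  change IsNilpotent (PowerSeries.constantCoeff _)
  simpa using hc

/-- Re-expansion of power series commutes with maps that are linear over a ring containing the
shift. -/
theorem map_coeff_subst_X_add_C {A B : Type*} [CommRing A] [CommRing B] (φ : B →+* A)
    (l : A →+ B) (hl : ∀ a b, l (a * φ b) = l a * b) {c : B} (hc : IsNilpotent c)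
    (G : PowerSeries A) (H : PowerSeries B)
    (h : ∀ n, l (PowerSeries.coeff n G) = PowerSeries.coeff n H) (n : ℕ) :
    l (PowerSeries.coeff n (PowerSeries.subst (PowerSeries.X + PowerSeries.C (φ c)) G)) =
      PowerSeries.coeff n (PowerSeries.subst (PowerSeries.X + PowerSeries.C c) H) := by
  rw [PowerSeries.coeff_subst' (hasSubst_X_add_C (hc.map φ)),
    PowerSeries.coeff_subst' (hasSubst_X_add_C hc), AddMonoidHom.map_finsum l
      (PowerSeries.coeff_subst_finite' (hasSubst_X_add_C (hc.map φ)) G n)]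
  refine finsum_congr fun d => ?_
  have : (PowerSeries.X + PowerSeries.C (φ c) : PowerSeries A) ^ d =
      PowerSeries.map φ ((PowerSeries.X + PowerSeries.C c) ^ d) := by simp
  rw [this, PowerSeries.coeff_map, smul_eq_mul, hl, h, smul_eq_mul]

theorem laurent_hom_ext {S : Type*} [CommRing S] {f g : ℤ[T;T⁻¹] →+* S}
    (h : f (LaurentPolynomial.T 1) = g (LaurentPolynomial.T 1)) : f = g := by
  refine IsLocalization.ringHom_ext (Submonoid.powers (Polynomial.X : ℤ[X])) ?_
  refine Polynomial.ringHom_ext (fun a => ?_) ?_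
  · simp
  · simpa [LaurentPolynomial.algebraMap_apply] using h

variable (Z : RootSystem) (p m : ℕ+) (N : ℕ)

/-- The image of `ζ_{pm} - ζ_m` in `ℤ[ζ_{pm}] / p^N`. -/
def cycShift : CycMod Z p (p * m) N := cycMk Z p (p * m) N (zeta Z (p * m) - zetaIn Z p m)

theorem isNilpotent_cycShift (hp : Nat.Prime p) : IsNilpotent (cycShift Z p m N) := by
  obtain ⟨n, hn⟩ := root_pow_eq Z hp m
  have h0 : (((p : ℕ) : ℕ) : Cyc Z (p * m) ⧸ Ideal.span {((p : ℕ) : Cyc Z (p * m))}) = 0 := by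
    rw [← map_natCast (Ideal.Quotient.mk _), Ideal.Quotient.eq_zero_iff_mem]
    exact Ideal.mem_span_singleton_self _
  have hz : zeta Z (p * m) ^ (p : ℕ) ^ n = zetaIn Z p m ^ (p : ℕ) ^ n := Subtype.ext hn
  have hmem : (zeta Z (p * m) - zetaIn Z p m) ^ (p : ℕ) ^ n ∈
      Ideal.span {((p : ℕ) : Cyc Z (p * m))} := by
    rw [← Ideal.Quotient.eq_zero_iff_mem, map_pow, map_sub, sub_pow_pow hp h0, ← map_pow,
      ← map_pow, hz, sub_self]
  refine ⟨(p : ℕ) ^ n * N, ?_⟩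
  rw [cycShift, ← map_pow, Ideal.Quotient.eq_zero_iff_mem, pow_mul, ← Ideal.span_singleton_pow]
  exact Ideal.pow_mem_pow hmem N

theorem laurentAt_T_one (m : ℕ+) : laurentAt Z m (LaurentPolynomial.T 1) =
    PowerSeries.C (zeta Z m) + PowerSeries.X := by
  rw [laurentAt, LaurentPolynomial.eval₂_T, zpow_one]
  rfl

/-- Re-expansion at `ζ_{pm}` of the expansion at `ζ_m` of a Laurent polynomial is the expansion
at `ζ_{pm}`. -/
theorem subst_laurentAt (hp : Nat.Prime p) (a : ℤ[T;T⁻¹]) :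
    PowerSeries.subst (PowerSeries.X + PowerSeries.C (cycShift Z p m N))
      (PowerSeries.map ((cycMk Z p (p * m) N).comp (cycIncl Z p m).toRingHom)
        (laurentAt Z m a)) =
      PowerSeries.map (cycMk Z p (p * m) N) (laurentAt Z (p * m) a) := by
  have hS := hasSubst_X_add_C (isNilpotent_cycShift Z p m N hp)
  rw [← PowerSeries.coe_substAlgHom hS]
  suffices h : ((PowerSeries.substAlgHom (R := CycMod Z p (p * m) N) hS).toRingHom.comp
      (PowerSeries.map ((cycMk Z p (p * m) N).comp (cycIncl Z p m).toRingHom))).comp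
        (laurentAt Z m) =
      (PowerSeries.map (cycMk Z p (p * m) N)).comp (laurentAt Z (p * m)) from
    RingHom.congr_fun h a
  -- Both sides are ring homomorphisms in the Laurent polynomial, so it is enough that both send `q`
  -- to `ζ_{pm} + X`.
  refine laurent_hom_ext ?_
  rw [RingHom.comp_apply, RingHom.comp_apply, RingHom.comp_apply, laurentAt_T_one,
    laurentAt_T_one, map_add, map_add (PowerSeries.map (cycMk Z p (p * m) N)), PowerSeries.map_C,
    PowerSeries.map_X, PowerSeries.map_C, PowerSeries.map_X]
  change PowerSeries.substAlgHom hS _ = _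
  rw [map_add, PowerSeries.coe_substAlgHom, PowerSeries.subst_C, PowerSeries.subst_X hS]
  have h1 : zeta Z (p * m) = cycIncl Z p m (zeta Z m) + (zeta Z (p * m) - zetaIn Z p m) :=
    (add_sub_cancel (zetaIn Z p m) (zeta Z (p * m))).symm
  have h2 : cycMk Z p (p * m) N (zeta Z (p * m)) =
      ((cycMk Z p (p * m) N).comp (cycIncl Z p m).toRingHom) (zeta Z m) + cycShift Z p m N :=
    (congrArg (cycMk Z p (p * m) N) h1).trans (RingHom.map_add _ _ _)
  rw [h2, RingHom.map_add, add_assoc, add_comm (PowerSeries.C (cycShift Z p m N))]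
  rfl

variable {σ : Type*} [Fintype σ] (Q : Matrix σ σ ℤ)

/-- The constants `ℤ[ζ_m] / p^N → R_m / p^N`. -/
def constMod : CycMod Z p m N →+*
    Ext (σ := σ) (RatRing Q) Z m ⧸ pIdeal (σ := σ) (RatRing Q) Z p m ^ N :=
  Ideal.Quotient.lift _ ((Ideal.Quotient.mk _).comp
    ((ofRootPoly Z m (RatRing Q)).comp (RootPoly.const Z m))) (by
      intro x hx
      rw [Ideal.mem_span_singleton] at hx
      rw [RingHom.comp_apply, Ideal.Quotient.eq_zero_iff_mem, Ideal.span_singleton_pow,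
        Ideal.mem_span_singleton]
      simpa only [map_pow, map_natCast] using
        map_dvd ((ofRootPoly Z m (RatRing Q)).comp (RootPoly.const Z m)) hx)

theorem expandMod_constMod (u : CycMod Z p m N) :
    expandMod Q Z p m N (constMod Z p m N Q u) = MvPowerSeries.C u := by
  obtain ⟨z, rfl⟩ := Ideal.Quotient.mk_surjective u
  change MvPowerSeries.map (cycMk Z p m N) (expand Q Z m (1 ⊗ₜ RootPoly.const Z m z)) = _
  rw [expand_const, MvPowerSeries.map_C]

variable {Q Z}

/-- A collection that is given by a single `f ∈ ℤ[q, q⁻¹]⟦t⟧` satisfies the gluing conditions. -/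
theorem IsExpansion.mem_habiroRing {f : MvPowerSeries σ ℤ[T;T⁻¹]} {F : Family σ (RatRing Q) Z}
    (hF : IsExpansion Q Z f F) : F ∈ habiroRing σ (RatRing Q) Z := by
  simp only [habiroRing, Subring.mem_iInf]
  intro m p hp N
  change reexpand (RatRing Q) Z hp m N F = twist (RatRing Q) Z hp m N F
  ext n
  refine expandMod_injective Q Z p (p * m) N (MvPowerSeries.ext fun k => ?_)
  -- Extracting the coefficient of `s^k` is not multiplicative, but it is linear over the constants.
  -- The shift `ζ_{pm} - ζ_m` is a constant, so extraction commutes with re-expansion.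
  let l : Ext (σ := σ) (RatRing Q) Z (p * m) ⧸ pIdeal (σ := σ) (RatRing Q) Z p (p * m) ^ N →+
      CycMod Z p (p * m) N :=
    (MvPowerSeries.coeff (R := CycMod Z p (p * m) N) k).toAddMonoidHom.comp
      (expandMod Q Z p (p * m) N).toAddMonoidHom
  have hl : ∀ a b, l (a * constMod Z p (p * m) N Q b) = l a * b := by
    intro a b
    change MvPowerSeries.coeff k (expandMod Q Z p (p * m) N (a * _)) =
      MvPowerSeries.coeff k (expandMod Q Z p (p * m) N a) * b
    rw [map_mul, expandMod_constMod, MvPowerSeries.coeff_mul_C]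
  have key := map_coeff_subst_X_add_C (constMod Z p (p * m) N Q) l hl
    (isNilpotent_cycShift Z p m N hp)
    (PowerSeries.map ((Ideal.Quotient.mk (pIdeal (σ := σ) (RatRing Q) Z p (p * m) ^ N)).comp
      (Ext.incl (σ := σ) (RatRing Q) Z p m)) (F m))
  have hleft : MvPowerSeries.coeff k (expandMod Q Z p (p * m) N
      (PowerSeries.coeff n (reexpand (RatRing Q) Z hp m N F))) =
      l (PowerSeries.coeff n (PowerSeries.subst
        (PowerSeries.X + PowerSeries.C (constMod Z p (p * m) N Q (cycShift Z p m N)))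
        (PowerSeries.map ((Ideal.Quotient.mk (pIdeal (σ := σ) (RatRing Q) Z p (p * m) ^ N)).comp
          (Ext.incl (σ := σ) (RatRing Q) Z p m)) (F m)))) := by
    change MvPowerSeries.coeff k (expandMod Q Z p (p * m) N (PowerSeries.coeff n
      (PowerSeries.substAlgHom (hasSubst_shift (σ := σ) (RatRing Q) Z hp m N) _))) = _
    rw [PowerSeries.coe_substAlgHom]
    rfl
  have hright : MvPowerSeries.coeff k (expandMod Q Z p (p * m) N
      (PowerSeries.coeff n (twist (RatRing Q) Z hp m N F))) =
      MvPowerSeries.coeff k (MvPowerSeries.expand p p.ne_zero (MvPowerSeries.map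
        (cycMk Z p (p * m) N) (expand Q Z (p * m) (PowerSeries.coeff n (F (p * m)))))) := by
    rw [← expandMod_frobenius Q Z p (p * m) N hp]
    rfl
  have hG : ∀ d, l (PowerSeries.coeff d (PowerSeries.map ((Ideal.Quotient.mk
      (pIdeal (σ := σ) (RatRing Q) Z p (p * m) ^ N)).comp
      (Ext.incl (σ := σ) (RatRing Q) Z p m)) (F m))) =
      MvPowerSeries.coeff k (MvPowerSeries.expand p p.ne_zero (MvPowerSeries.map
        ((cycMk Z p (p * m) N).comp (cycIncl Z p m).toRingHom)
          (expand Q Z m (PowerSeries.coeff d (F m))))) := by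
    intro d
    rw [← expandMod_incl Q Z p m N, PowerSeries.coeff_map]
    rfl
  rw [hleft, hright]
  -- Both sides are series in `s^p`. For `k = p j` both coefficients come from the coefficient of
  -- `t^j` in `f`; for other `k` both vanish.
  by_cases hk : ∀ i, (p : ℕ) ∣ k i
  · obtain ⟨j, rfl⟩ : ∃ j : σ →₀ ℕ, k = (p : ℕ) • j := by
      choose g hg using hk
      refine ⟨Finsupp.equivFunOnFinite.symm g, Finsupp.ext fun i => ?_⟩
      simp [hg]
    rw [key (PowerSeries.map ((cycMk Z p (p * m) N).comp (cycIncl Z p m).toRingHom)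
      (laurentAt Z m (MvPowerSeries.coeff j f))), subst_laurentAt Z p m N hp,
      MvPowerSeries.coeff_expand_smul, MvPowerSeries.coeff_map, PowerSeries.coeff_map, hF]
    intro d
    rw [hG, MvPowerSeries.coeff_expand_smul, MvPowerSeries.coeff_map, PowerSeries.coeff_map, hF]
  · push Not at hk
    obtain ⟨i, hi⟩ := hk
    rw [key 0, MvPowerSeries.coeff_expand_of_not_dvd _ _ _ hi]
    · rw [← PowerSeries.coe_substAlgHom (hasSubst_X_add_C (isNilpotent_cycShift Z p m N hp)),
        map_zero, map_zero]
    · intro d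
      rw [hG, MvPowerSeries.coeff_expand_of_not_dvd _ _ _ hi, map_zero]

theorem IsExpansion.unique {f : MvPowerSeries σ ℤ[T;T⁻¹]} {F G : Family σ (RatRing Q) Z}
    (hF : IsExpansion Q Z f F) (hG : IsExpansion Q Z f G) : F = G := by
  funext m
  refine PowerSeries.ext fun n => expand_injective Q Z m (MvPowerSeries.ext fun k => ?_)
  rw [hF, hG]

theorem exists_isExpansion_qSeries (hQ : Q.IsSymm) (Z : RootSystem) :
    ∃ F : Family σ (RatRing Q) Z, IsExpansion Q Z (qSeries Q) F := by
  -- Any order will do: it enters the `q`-difference equation but neither the series nor the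
  -- denominator.
  let _ : LinearOrder σ := LinearOrder.lift' _ (Fintype.equivFin σ).injective
  choose x hx using fun (m : ℕ+) (n : ℕ) =>
    exists_expand_eq Q Z m (taylorCoeff_mem_ratSeries Q hQ Z m n)
  refine ⟨fun m => PowerSeries.mk (x m), fun m k n => ?_⟩
  rw [PowerSeries.coeff_mk, hx, coeff_taylorCoeff]

end Gluing

end Habiro

end

theorem theorem1p3 {σ : Type*} [Fintype σ] (Q : Matrix σ σ ℤ) (hQ : Q.IsSymm)
    (Z : Habiro.RootSystem) :
    ∃! F : Habiro.Family σ (Habiro.RatRing Q) Z,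
      F ∈ Habiro.habiroRing σ (Habiro.RatRing Q) Z ∧
        Habiro.IsExpansion Q Z (Habiro.qSeries Q) F := by
  obtain ⟨F, hF⟩ := Habiro.exists_isExpansion_qSeries hQ Z
  exact ⟨F, ⟨hF.mem_habiroRing, hF⟩, fun _ hG => hG.2.unique hF⟩
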